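/- Let $\Bbbk$ be a field of characteristic $0$ and let $H$ be a finite-dimensional semisimple Hopf algebra over $\Bbbk$, with comultiplication $\Delta(h)=\sum h_1\otimes h_2$, counit $\varepsilon$ and antipode $S$. Let $B$ be a right $H$-comodule $\Bbbk$-algebra with coaction $b\mapsto\sum b_0\otimes b_1\in B\otimes H$, and let $A:=B^{\mathrm{co}H}=\{b\in B\mid \sum b_0\otimes b_1=b\otimes 1\}$. Suppose that $A\subseteq B$ is $H$-Galois, that is, the map $B\otimes_A B\to B\otimes H$, $b'\otimes b\mapsto\sum b'b_0\otimes b_1$, is bijective. Let $0\neq\alpha\in H^*$ be a left integral of $H^*$, that is, $\sum h_1\langle\alpha,h_2\rangle=\langle\alpha,h\rangle 1$ for all $h\in H$, and let $t\in H$ satisfy $\langle\alpha,hS(t)\rangle=\varepsilon(h)$ for all $h\in H$ (such a $t$ is a right integral of $H$). For $f\in H^*$ and $b\in B$ write $f\rightharpoonup b:=\sum b_0\langle f,b_1\rangle$. For a ring $R$ let $[R,R]$ be the additive subgroup generated by all $xy-yx$ with $x,y\in R$. Then $B$ is a finitely generated projective right $A$-module, so that the Hattori–Stallings map $\mathrm{tr}_{B_A}\colon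 B\to A/[A,A]$ is defined; it is given by $\mathrm{tr}_{B_A}(b)=\sum_i x_i^*(bx_i)+[A,A]$ for any dual basis $x_1,\dots,x_n\in B$, $x_1^*,\dots,x_n^*\in\mathrm{Hom}_A(B_A,A_A)$ of $B_A$. For all $b\in B$, $$\mathrm{tr}_{B_A}(b)+[B,B]=(\varepsilon(t)\alpha)\rightharpoonup b+[B,B]\quad\text{in } B/[B,B],$$ where the left-hand side is the image of $\mathrm{tr}_{B_A}(b)$ under the map $A/[A,A]\to B/[B,B]$ induced by the inclusion. Further, if $B$ is a prime ring and $A$ is central in $B$ (so that $[A,A]=0$ and $\mathrm{tr}_{B_A}$ takes values in $A$), then $(\varepsilon(t)\alpha)\rightharpoonup b\in A$ and $\mathrm{tr}_{B_A}(b)=(\varepsilon(t)\alpha)\rightharpoonup b$ for all $b\in B$. -/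

import Mathlib

open scoped TensorProduct

namespace HopfGaloisTrace

universe u v w

section Rings

/-- The additive subgroup `[R, R]` of a ring `R`, generated by all `a * b - b * a`. -/
def addCommutator (R : Type u) [Ring R] : AddSubgroup R :=
  AddSubgroup.closure {x | ∃ a b : R, x = a * b - b * a}

/-- The additive group `R / [R, R]`. -/
abbrev ModCommutator (R : Type u) [Ring R] : Type u := R ⧸ addCommutator R

/-- The projection `R → R / [R, R]`. -/
abbrev modComm (R : Type u) [Ring R] : R →+ ModCommutator R :=
  QuotientAddGroup.mk' (addCommutator R)

theorem addCommutator_le_comap {R : Type u} {S : Type v} [Ring R] [Ring S] (f : R →+* S) :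
    addCommutator R ≤ (addCommutator S).comap f.toAddMonoidHom := by
  refine (AddSubgroup.closure_le _).2 ?_
  rintro _ ⟨a, b, rfl⟩
  refine AddSubgroup.subset_closure ⟨f a, f b, ?_⟩
  simp

/-- The additive map `R / [R, R] → S / [S, S]` induced by a ring homomorphism `R → S`. -/
def ModCommutator.map {R : Type u} {S : Type v} [Ring R] [Ring S] (f : R →+* S) :
    ModCommutator R →+ ModCommutator S :=
  QuotientAddGroup.map _ _ f.toAddMonoidHom (addCommutator_le_comap f)

/-- A ring is prime if it is nonzero and `a R b = 0` implies `a = 0` or `b = 0`. -/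
def IsPrimeRing (R : Type u) [Ring R] : Prop :=
  Nontrivial R ∧ ∀ a b : R, (∀ r : R, a * r * b = 0) → a = 0 ∨ b = 0

end Rings

section Balanced

variable (R : Type u) [Ring R] (M : Type v) [AddCommGroup M] [Module Rᵐᵒᵖ M]
  (N : Type w) [AddCommGroup N] [Module R N]

/-- The relations `(m r) ⊗ n = m ⊗ (r n)` in `M ⊗[ℤ] N`. -/
def balancedRel : AddSubgroup (M ⊗[ℤ] N) :=
  AddSubgroup.closure {x | ∃ (m : M) (r : R) (n : N),
    x = (MulOpposite.op r • m) ⊗ₜ[ℤ] n - m ⊗ₜ[ℤ] (r • n)}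

/-- The tensor product `M ⊗_R N` of a right `R`-module `M` and a left `R`-module `N` over a
(possibly noncommutative) ring `R`; right modules are modules over the opposite ring. -/
abbrev BalancedTensor : Type (max v w) := (M ⊗[ℤ] N) ⧸ balancedRel R M N

variable {M N}

/-- The pure tensor `m ⊗ n` in `M ⊗_R N`. -/
def BalancedTensor.tmul (m : M) (n : N) : BalancedTensor R M N :=
  QuotientAddGroup.mk (m ⊗ₜ[ℤ] n)

theorem BalancedTensor.tmul_add (m : M) (n n' : N) :
    tmul R m (n + n') = tmul R m n + tmul R m n' := by
  simp [tmul, TensorProduct.tmul_add]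

theorem BalancedTensor.add_tmul (m m' : M) (n : N) :
    tmul R (m + m') n = tmul R m n + tmul R m' n := by
  simp [tmul, TensorProduct.add_tmul]

theorem BalancedTensor.smul_tmul (m : M) (r : R) (n : N) :
    tmul R (MulOpposite.op r • m) n = tmul R m (r • n) := by
  rw [← sub_eq_zero]
  exact (QuotientAddGroup.eq_zero_iff _).2 (AddSubgroup.subset_closure ⟨m, r, n, rfl⟩)

variable {R}

theorem BalancedTensor.induction_on {p : BalancedTensor R M N → Prop}
    (z : BalancedTensor R M N) (h0 : p 0) (ht : ∀ m n, p (tmul R m n))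
    (ha : ∀ x y, p x → p y → p (x + y)) : p z := by
  induction z using QuotientAddGroup.induction_on with
  | H z =>
    induction z using TensorProduct.induction_on with
    | zero => exact h0
    | tmul m n => exact ht m n
    | add x y hx hy => exact ha _ _ hx hy

/-- The universal property: a balanced biadditive map `M × N → P` induces an additive map
`M ⊗_R N → P`. -/
def BalancedTensor.lift {P : Type*} [AddCommGroup P] (f : M →+ N →+ P)
    (hf : ∀ (m : M) (r : R) (n : N), f (MulOpposite.op r • m) n = f m (r • n)) :
    BalancedTensor R M N →+ P :=
  QuotientAddGroup.lift _
    (TensorProduct.liftAddHom f (fun c m n => by simp) : M ⊗[ℤ] N →+ P) <| by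
      refine (AddSubgroup.closure_le _).2 ?_
      rintro _ ⟨m, r, n, rfl⟩
      simp [hf]

@[simp] theorem BalancedTensor.lift_tmul {P : Type*} [AddCommGroup P] (f : M →+ N →+ P)
    (hf : ∀ (m : M) (r : R) (n : N), f (MulOpposite.op r • m) n = f m (r • n)) (m : M) (n : N) :
    BalancedTensor.lift f hf (tmul R m n) = f m n := rfl

end Balanced

section HattoriStallings

variable (R : Type u) [Ring R] (P : Type v) [AddCommGroup P] [Module Rᵐᵒᵖ P]

/-- The dual `Hom_R(P, R)` of a right `R`-module `P`. Its left `R`-module structure, found by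
instance search, is `(r f)(x) = r * f x`. -/
abbrev RightDual : Type (max u v) := P →ₗ[Rᵐᵒᵖ] R

/-- The map `φ_P : P ⊗_R Hom_R(P, R) → End_R(P)`, `x ⊗ f ↦ (y ↦ x f(y))`. -/
def hsPhi : BalancedTensor R P (RightDual R P) →+ Module.End Rᵐᵒᵖ P :=
  BalancedTensor.lift
    (AddMonoidHom.mk' (fun x => AddMonoidHom.mk'
        (fun f : RightDual R P =>
          ({ toFun := fun y => MulOpposite.op (f y) • x
             map_add' := fun y z => by simp [add_smul]
             map_smul' := fun r y => by simp [mul_smul] } : Module.End Rᵐᵒᵖ P))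
        (fun f g => by ext y; simp [add_smul]))
      (fun x x' => by ext f y; simp))
    (fun x r f => by ext y; simp [mul_smul])

/-- The map `ψ_P : P ⊗_R Hom_R(P, R) → R / [R, R]`, `x ⊗ f ↦ f(x) + [R, R]`. -/
def hsPsi : BalancedTensor R P (RightDual R P) →+ ModCommutator R :=
  BalancedTensor.lift
    (AddMonoidHom.mk' (fun x => AddMonoidHom.mk'
        (fun f : RightDual R P => modComm R (f x)) (fun f g => by simp))
      (fun x x' => by ext f; simp))
    (fun x r f => by
      change modComm R (f (MulOpposite.op r • x)) = modComm R ((r • f) x)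
      rw [← sub_eq_zero, ← map_sub]
      refine (QuotientAddGroup.eq_zero_iff _).2 (AddSubgroup.subset_closure ⟨f x, r, ?_⟩)
      simp)

theorem hsPhi_tmul (x : P) (f : RightDual R P) (y : P) :
    hsPhi R P (BalancedTensor.tmul R x f) y = MulOpposite.op (f y) • x := rfl

theorem hsPsi_tmul (x : P) (f : RightDual R P) :
    hsPsi R P (BalancedTensor.tmul R x f) = modComm R (f x) := rfl

theorem exists_dualBasis [Module.Finite Rᵐᵒᵖ P] [Module.Projective Rᵐᵒᵖ P] :
    ∃ (n : ℕ) (x : Fin n → P) (f : Fin n → RightDual R P),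
      ∀ y, ∑ i, MulOpposite.op (f i y) • x i = y := by
  obtain ⟨n, F, G, -, -, h⟩ := Module.Finite.exists_comp_eq_id_of_projective Rᵐᵒᵖ P
  refine ⟨n, fun i => F (Pi.single i 1), fun i =>
    { toFun := fun y => (G y i).unop
      map_add' := fun y z => by simp
      map_smul' := fun r y => by simp }, fun y => ?_⟩
  have hy : F (G y) = y := LinearMap.congr_fun h y
  conv_rhs => rw [← hy, ← Finset.univ_sum_single (G y), map_sum]
  refine Finset.sum_congr rfl fun i _ => ?_
  change MulOpposite.op (G y i).unop • F (Pi.single i 1) = _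
  rw [MulOpposite.op_unop, ← map_smul, ← Pi.single_smul, smul_eq_mul, mul_one]

theorem hsPhi_bijective [Module.Finite Rᵐᵒᵖ P] [Module.Projective Rᵐᵒᵖ P] :
    Function.Bijective (hsPhi R P) := by
  obtain ⟨n, x, f, h⟩ := exists_dualBasis R P
  constructor
  · -- a left inverse is `F ↦ ∑ F(x_i) ⊗ f_i`
    refine Function.LeftInverse.injective
      (g := fun F => ∑ i, BalancedTensor.tmul R (F (x i)) (f i)) fun z => ?_
    induction z using BalancedTensor.induction_on with
    | h0 =>
      refine Finset.sum_eq_zero fun i _ => ?_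
      rw [map_zero, LinearMap.zero_apply]
      simp [BalancedTensor.tmul]
    | ht y g =>
      have hg : ∑ i, g (x i) • f i = g := by
        ext z
        conv_rhs => rw [← h z, map_sum]
        simp
      simp only [hsPhi_tmul, BalancedTensor.smul_tmul]
      conv_rhs => rw [← hg]
      exact (map_sum (AddMonoidHom.mk' (fun g => BalancedTensor.tmul R y g)
        (BalancedTensor.tmul_add R y)) _ _).symm
    | ha a b ha hb =>
      conv_rhs => rw [← ha, ← hb]
      rw [← Finset.sum_add_distrib]
      refine Finset.sum_congr rfl fun i _ => ?_
      rw [map_add, LinearMap.add_apply, BalancedTensor.add_tmul]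
  · intro F
    refine ⟨∑ i, BalancedTensor.tmul R (F (x i)) (f i), ?_⟩
    ext y
    rw [map_sum, LinearMap.sum_apply]
    simp only [hsPhi_tmul]
    conv_rhs => rw [← h y, map_sum]
    simp

/-- The Hattori–Stallings map `tr_P = ψ_P ∘ φ_P⁻¹ : End_R(P) → R / [R, R]` of a finitely generated
projective right `R`-module `P`. -/
noncomputable def hattoriStallings [Module.Finite Rᵐᵒᵖ P] [Module.Projective Rᵐᵒᵖ P] :
    Module.End Rᵐᵒᵖ P →+ ModCommutator R :=
  (hsPsi R P).comp
    (AddEquiv.ofBijective (hsPhi R P) (hsPhi_bijective R P)).symm.toAddMonoidHom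

end HattoriStallings

section Extension

variable {k : Type u} [CommRing k] {B : Type v} [Ring B] [Algebra k B]

/-- `B` as a right module over a subalgebra `A`, by `b · a = b * a`. -/
instance rightModule (A : Subalgebra k B) : Module (A)ᵐᵒᵖ B :=
  Module.compHom B (A.val.toRingHom.op)

theorem op_smul_def (A : Subalgebra k B) (a : A) (b : B) :
    MulOpposite.op a • b = b * (a : B) := rfl

/-- Left multiplication by `b`, as an endomorphism of the right `A`-module `B`. -/
def leftMul (A : Subalgebra k B) (b : B) : Module.End (A)ᵐᵒᵖ B where
  toFun x := b * x
  map_add' x y := mul_add b x y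
  map_smul' a x := (mul_assoc b x (a.unop : B)).symm

/-- The Hattori–Stallings map `tr_{B_A} : B → A / [A, A]` of a ring extension `A ⊆ B` such that
`B` is finitely generated projective as a right `A`-module. -/
noncomputable def extensionTrace (A : Subalgebra k B) [Module.Finite (A)ᵐᵒᵖ B]
    [Module.Projective (A)ᵐᵒᵖ B] (b : B) : ModCommutator A :=
  hattoriStallings A B (leftMul A b)

end Extension

section Hopf

variable (k : Type u) [Field k] (H : Type v) [Ring H] [HopfAlgebra k H]

/-- A right `H`-comodule algebra: an algebra `B` with a coassociative and counital coaction
`ρ : B → B ⊗ H`, `b ↦ ∑ b₀ ⊗ b₁`, that is an algebra homomorphism. -/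
class RightComoduleAlgebra (B : Type w) [Ring B] [Algebra k B] where
  coaction : B →ₐ[k] B ⊗[k] H
  coassoc :
    (TensorProduct.assoc k B H H).toLinearMap ∘ₗ
        coaction.toLinearMap.rTensor H ∘ₗ coaction.toLinearMap =
      (Coalgebra.comul (R := k) (A := H)).lTensor B ∘ₗ coaction.toLinearMap
  counital :
    (TensorProduct.rid k B).toLinearMap ∘ₗ
        (Coalgebra.counit (R := k) (A := H)).lTensor B ∘ₗ coaction.toLinearMap =
      LinearMap.id

variable (B : Type w) [Ring B] [Algebra k B] [RightComoduleAlgebra k H B]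

/-- The coaction `ρ : B → B ⊗ H`. -/
abbrev coact : B →ₐ[k] B ⊗[k] H := RightComoduleAlgebra.coaction

/-- The subalgebra `B^{co H} = {b | ρ(b) = b ⊗ 1}` of coinvariants. -/
def coinvariants : Subalgebra k B :=
  AlgHom.equalizer (coact k H B) Algebra.TensorProduct.includeLeft

theorem mem_coinvariants (b : B) :
    b ∈ coinvariants k H B ↔ coact k H B b = b ⊗ₜ[k] (1 : H) := Iff.rfl

/-- The canonical map `β : B ⊗_{B^{co H}} B → B ⊗ H`, `b' ⊗ b ↦ ∑ b' b₀ ⊗ b₁`. -/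
def galoisMap : BalancedTensor (coinvariants k H B) B B →+ B ⊗[k] H :=
  BalancedTensor.lift
    (AddMonoidHom.mk' (fun b' => AddMonoidHom.mk'
        (fun b => (b' ⊗ₜ[k] (1 : H)) * coact k H B b) (fun x y => by simp [mul_add]))
      (fun x y => by ext b; simp [TensorProduct.add_tmul, add_mul]))
    (fun b' a b => by
      have ha : coact k H B (a : B) = (a : B) ⊗ₜ[k] (1 : H) := a.2
      change ((b' * (a : B)) ⊗ₜ[k] (1 : H)) * coact k H B b =
        (b' ⊗ₜ[k] (1 : H)) * coact k H B ((a : B) * b)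
      rw [map_mul, ha, ← mul_assoc, Algebra.TensorProduct.tmul_mul_tmul, mul_one])

/-- `B^{co H} ⊆ B` is an `H`-Galois extension if the canonical map is bijective. -/
def IsHopfGalois : Prop := Function.Bijective (galoisMap k H B)

variable {k H B}

/-- The action `f ⇀ b = ∑ b₀ ⟨f, b₁⟩` of `f ∈ H*` on `b ∈ B`. -/
def dualAct (f : Module.Dual k H) (b : B) : B :=
  TensorProduct.rid k B (f.lTensor B (coact k H B b))

/-- `α` is a left integral of `H*`: `∑ h₁ ⟨α, h₂⟩ = ⟨α, h⟩ 1` for all `h ∈ H`. -/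
def IsLeftIntegralOfDual (α : Module.Dual k H) : Prop :=
  ∀ h : H, TensorProduct.rid k H (α.lTensor H (Coalgebra.comul (R := k) h)) =
    algebraMap k H (α h)

/-- The functional `f ↼ h` on `H` given by `⟨f ↼ h, x⟩ = ⟨f, x S(h)⟩`, with `S` the antipode. -/
def dualRightAct (f : Module.Dual k H) (h : H) : Module.Dual k H :=
  f ∘ₗ LinearMap.mulRight k (HopfAlgebra.antipode k h)

end Hopf

end HopfGaloisTrace

/-! Choose `r_i`, `l_i` in `B` with `∑ (r_i ⊗ 1) ρ(l_i) = 1 ⊗ S(t)`, a lift along the canonical map.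
Suppose that `α` is a trace functional, `α(xy) = α(yx)`. Then `α(S(t)x) = α(xS(t)) = ε(x)`, so `∑
r_i (α ⇀ (l_i b)) = b`: the `r_i` and the maps `b ↦ α ⇀ (l_i b)` are a dual basis of `B_A`. Hence
`tr(b)` is represented by `∑ α ⇀ (l_i b r_i)`. Modulo `[B,B]` the trace property turns this into `∑
α ⇀ (r_i l_i b)`, and `id ⊗ ε` applied to the lift gives `∑ r_i l_i = ε(t)1`.

That `α` is a trace functional (`IsLeftIntegralOfDual.apply_mul_comm`) is the theorem of Larson and
Radford: the Nakayama automorphism of `α` is `S²`, and `S² = id` for semisimple `H` in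
characteristic 0. Over an algebraically closed field `S²` is conjugation by a unit `u` with a
central power. On each matrix block `u` is a scalar times a matrix of finite order, so `α(1) =
tr(S²) = ∑ tr(u) tr(u⁻¹)` is, after an embedding in `ℂ`, a sum of squared absolute values. It cannot
vanish (`apply_one_ne_zero`). Then `S⁴ = id`, and an integrality argument on `tr(S²)` gives `S² =
id` (`antipodeSq_eq_id`). The integral of `H` and Maschke's theorem carry the hypotheses to the
algebraic closure.

If `B` is prime and `A` central, the two sides differ by an element `a` of `A ∩ [B,B]`. The trace to
`A` is `A`-linear and kills `[B,B]`, so `tr(1)a = 0`, while `tr(1)` is the trace of a nonzero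
idempotent matrix over a field of characteristic 0. Thus `a = 0` (`eq_zero_of_mem_addCommutator`).
-/

open scoped TensorProduct

namespace HopfGaloisTrace

/-! ### Sweedler calculus -/

section Sweedler

open Coalgebra HopfAlgebra

/-- The sum `∑ f(x₁, x₂)`. -/
noncomputable def sw (k : Type*) [Field k] {H : Type*} [Ring H] [HopfAlgebra k H]
    {M : Type*} [AddCommGroup M] (x : H) (f : H → H → M) : M :=
  ∑ i ∈ (Repr.arbitrary k x).index, f ((Repr.arbitrary k x).left i) ((Repr.arbitrary k x).right i)

theorem sw_fun_add {k : Type*} [Field k] {H : Type*} [Ring H] [HopfAlgebra k H]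
    {M : Type*} [AddCommGroup M] (x : H) (f g : H → H → M) :
    (sw k x fun a b => f a b + g a b) = sw k x f + sw k x g := Finset.sum_add_distrib

theorem smul_sw {k : Type*} [Field k] {H : Type*} [Ring H] [HopfAlgebra k H]
    {M : Type*} [AddCommGroup M] [Module k M] (c : k) (f : H → H → M) (x : H) :
    c • sw k x f = sw k x fun a b => c • f a b := Finset.smul_sum

/-- A function of two variables that is linear in each of them. -/
structure IsBilin (k : Type*) {U V M : Type*} [CommRing k] [AddCommGroup U] [Module k U]
    [AddCommGroup V] [Module k V] [AddCommGroup M] [Module k M] (f : U → V → M) : Prop where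
  -- The tactic defaults let `{}` prove multilinearity of the explicit Sweedler expressions below.
  add_left : ∀ a a' b, f (a + a') b = f a b + f a' b := by
    intros
    try simp only [map_add, map_smul, LinearMap.add_apply, LinearMap.smul_apply,
      mul_add, add_mul, smul_mul_assoc, mul_smul_comm,
      TensorProduct.tmul_add, TensorProduct.add_tmul, TensorProduct.tmul_smul,
      ← TensorProduct.smul_tmul', smul_eq_mul, smul_add, add_smul, sw_fun_add]
    first | done | module | ring
  smul_left : ∀ (c : k) a b, f (c • a) b = c • f a b := by
    intro c _ _
    try simp only [map_add, map_smul, LinearMap.add_apply, LinearMap.smul_apply,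
      mul_add, add_mul, smul_mul_assoc, mul_smul_comm,
      TensorProduct.tmul_add, TensorProduct.add_tmul, TensorProduct.tmul_smul,
      ← TensorProduct.smul_tmul', smul_eq_mul, smul_add, add_smul, mul_smul, smul_comm _ c,
      ← smul_sw]
    first | done | module | ring
  add_right : ∀ a b b', f a (b + b') = f a b + f a b' := by
    intros
    try simp only [map_add, map_smul, LinearMap.add_apply, LinearMap.smul_apply,
      mul_add, add_mul, smul_mul_assoc, mul_smul_comm,
      TensorProduct.tmul_add, TensorProduct.add_tmul, TensorProduct.tmul_smul,
      ← TensorProduct.smul_tmul', smul_eq_mul, smul_add, add_smul, sw_fun_add]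
    first | done | module | ring
  smul_right : ∀ (c : k) a b, f a (c • b) = c • f a b := by
    intro c _ _
    try simp only [map_add, map_smul, LinearMap.add_apply, LinearMap.smul_apply,
      mul_add, add_mul, smul_mul_assoc, mul_smul_comm,
      TensorProduct.tmul_add, TensorProduct.add_tmul, TensorProduct.tmul_smul,
      ← TensorProduct.smul_tmul', smul_eq_mul, smul_add, add_smul, mul_smul, smul_comm _ c,
      ← smul_sw]
    first | done | module | ring

/-- A function of three variables that is linear in each of them. -/
structure IsTrilin (k : Type*) {U V W M : Type*} [CommRing k] [AddCommGroup U] [Module k U]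
    [AddCommGroup V] [Module k V] [AddCommGroup W] [Module k W] [AddCommGroup M] [Module k M]
    (f : U → V → W → M) : Prop where
  add_left : ∀ a a' b c, f (a + a') b c = f a b c + f a' b c := by
    intros
    try simp only [map_add, map_smul, LinearMap.add_apply, LinearMap.smul_apply,
      mul_add, add_mul, smul_mul_assoc, mul_smul_comm,
      TensorProduct.tmul_add, TensorProduct.add_tmul, TensorProduct.tmul_smul,
      ← TensorProduct.smul_tmul', smul_eq_mul, smul_add, add_smul, sw_fun_add]
    first | done | module | ring
  smul_left : ∀ (r : k) a b c, f (r • a) b c = r • f a b c := by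
    intro r _ _ _
    try simp only [map_add, map_smul, LinearMap.add_apply, LinearMap.smul_apply,
      mul_add, add_mul, smul_mul_assoc, mul_smul_comm,
      TensorProduct.tmul_add, TensorProduct.add_tmul, TensorProduct.tmul_smul,
      ← TensorProduct.smul_tmul', smul_eq_mul, smul_add, add_smul, mul_smul, smul_comm _ r,
      ← smul_sw]
    first | done | module | ring
  right : ∀ a, IsBilin k (f a) := by exact fun _ => {}

/-- The bundled form of a bilinear function. -/
def IsBilin.toLin {k U V M : Type*} [CommRing k] [AddCommGroup U] [Module k U]
    [AddCommGroup V] [Module k V] [AddCommGroup M] [Module k M] {f : U → V → M}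
    (hf : IsBilin k f) : U →ₗ[k] V →ₗ[k] M :=
  LinearMap.mk₂ k f hf.add_left hf.smul_left hf.add_right hf.smul_right

variable (k : Type*) [Field k] {H : Type*} [Ring H] [HopfAlgebra k H]
  {M N : Type*} [AddCommGroup M] [Module k M] [AddCommGroup N] [Module k N]

variable {k}

theorem sw_eq_lift {f : H → H → M} (hf : IsBilin k f) (x : H) :
    sw k x f = TensorProduct.lift hf.toLin (comul x) := by
  rw [← (Repr.arbitrary k x).eq, map_sum]
  rfl

theorem sw_congr {M : Type*} [AddCommGroup M] {x : H} {f g : H → H → M}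
    (h : ∀ a b, f a b = g a b) : sw k x f = sw k x g :=
  Finset.sum_congr rfl fun _ _ => h _ _

theorem map_sw (g : M →ₗ[k] N) (f : H → H → M) (x : H) :
    g (sw k x f) = sw k x fun a b => g (f a b) := map_sum _ _ _

theorem mul_sw {R : Type*} [Ring R] (r : R) (f : H → H → R) (x : H) :
    r * sw k x f = sw k x fun a b => r * f a b := Finset.mul_sum _ _ _

theorem sw_mul_right {R : Type*} [Ring R] (r : R) (f : H → H → R) (x : H) :
    sw k x f * r = sw k x fun a b => f a b * r := Finset.sum_mul _ _ _

theorem sw_smul_right (m : M) (f : H → H → k) (x : H) :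
    sw k x f • m = sw k x fun a b => f a b • m := Finset.sum_smul

theorem tmul_sw (m : N) (f : H → H → M) (x : H) :
    m ⊗ₜ[k] sw k x f = sw k x fun a b => m ⊗ₜ[k] f a b := TensorProduct.tmul_sum _ _ _

theorem sw_tmul (m : N) (f : H → H → M) (x : H) :
    sw k x f ⊗ₜ[k] m = sw k x fun a b => f a b ⊗ₜ[k] m := TensorProduct.sum_tmul _ _ _

theorem sw_swap {M : Type*} [AddCommGroup M] {f : H → H → H → H → M} (x y : H) :
    (sw k x fun a b => sw k y fun c d => f a b c d) =
      sw k y fun c d => sw k x fun a b => f a b c d := Finset.sum_comm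

theorem sw_sum {M : Type*} [AddCommGroup M] {ι : Type*} (s : Finset ι) (f : ι → H → H → M) (x : H) :
    (sw k x fun a b => ∑ i ∈ s, f i a b) = ∑ i ∈ s, sw k x (f i) := Finset.sum_comm

theorem sw_zero {M : Type*} [AddCommGroup M] (x : H) : (sw k x fun _ _ => (0 : M)) = 0 := Finset.sum_const_zero

theorem sw_smul {f : H → H → M} (hf : IsBilin k f) (c : k) (x : H) :
    sw k (c • x) f = c • sw k x f := by
  simp [sw_eq_lift hf]

theorem sw_tensor (x : H) : (sw k x fun a b => a ⊗ₜ[k] b) = comul x := (Repr.arbitrary k x).eq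

theorem sw_of_comul_sw {f : H → H → M} (hf : IsBilin k f) (x y : H) (l r : H → H → H)
    (h : comul x = sw k y fun a b => l a b ⊗ₜ[k] r a b) :
    sw k x f = sw k y fun a b => f (l a b) (r a b) := by
  rw [sw_eq_lift hf, h, map_sw]
  rfl

theorem sw_mul {f : H → H → M} (hf : IsBilin k f) (x y : H) :
    sw k (x * y) f = sw k x fun a b => sw k y fun c d => f (a * c) (b * d) := by
  rw [sw_eq_lift hf, Bialgebra.comul_mul, ← sw_tensor x, ← sw_tensor y, sw_mul_right, map_sw]
  simp only [mul_sw, map_sw, Algebra.TensorProduct.tmul_mul_tmul]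
  rfl

theorem sw_groupLike {f : H → H → M} (hf : IsBilin k f) {g : H} (hg : comul g = g ⊗ₜ[k] g) :
    sw k g f = f g g := by
  rw [sw_eq_lift hf, hg]
  rfl

theorem sw_groupLike_mul {f : H → H → M} (hf : IsBilin k f) {g : H} (hg : comul g = g ⊗ₜ[k] g)
    (y : H) : sw k (g * y) f = sw k y fun a b => f (g * a) (g * b) := by
  rw [sw_eq_lift hf, Bialgebra.comul_mul, hg, ← sw_tensor y, mul_sw, map_sw]
  simp only [Algebra.TensorProduct.tmul_mul_tmul]
  rfl

theorem sw_one {f : H → H → M} (hf : IsBilin k f) : sw k (1 : H) f = f 1 1 :=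
  sw_groupLike hf Bialgebra.comul_one

theorem sw_counit_left (g : H →ₗ[k] M) (x : H) :
    (sw k x fun a b => counit (R := k) a • g b) = g x := by
  have h := congrArg (TensorProduct.lift (LinearMap.lsmul k M ∘ₗ LinearMap.id) ∘ₗ
    g.lTensor k) (rTensor_counit_comul (R := k) x)
  rw [← sw_tensor, map_sw, map_sw] at h
  simpa using h

theorem sw_counit_right (g : H →ₗ[k] M) (x : H) :
    (sw k x fun a b => counit (R := k) b • g a) = g x := by
  have h := congrArg (TensorProduct.lift (LinearMap.lsmul k M ∘ₗ LinearMap.id).flip ∘ₗ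
    g.rTensor k) (lTensor_counit_comul (R := k) x)
  rw [← sw_tensor, map_sw, map_sw] at h
  simpa using h

theorem sw_antipode_mul (x : H) :
    (sw k x fun a b => antipode k a * b) = counit (R := k) x • 1 :=
  sum_antipode_mul_eq_smul _

theorem sw_mul_antipode (x : H) :
    (sw k x fun a b => a * antipode k b) = counit (R := k) x • 1 :=
  sum_mul_antipode_eq_smul _

/-- The bundled form of a trilinear function, on the tensor product. -/
def IsTrilin.toLin {U V W M : Type*} [AddCommGroup U] [Module k U]
    [AddCommGroup V] [Module k V] [AddCommGroup W] [Module k W] [AddCommGroup M] [Module k M]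
    {f : U → V → W → M} (hf : IsTrilin k f) : U ⊗[k] (V ⊗[k] W) →ₗ[k] M :=
  TensorProduct.lift
    { toFun := fun a => TensorProduct.lift (hf.right a).toLin
      map_add' := fun a a' => by
        ext b c
        exact hf.add_left a a' b c
      map_smul' := fun r a => by
        ext b c
        exact hf.smul_left r a b c }

/-- Coassociativity. Since `f` is trilinear, both sides are its linear extension applied to the same
element of `H ⊗ H ⊗ H`, whatever representatives the inner sums use. -/
theorem sw_assoc {f : H → H → H → M} (hf : IsTrilin k f) (x : H) :
    (sw k x fun p c => sw k p fun a b => f a b c) =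
      sw k x fun a q => sw k q fun b c => f a b c := by
  have h := congrArg hf.toLin (sum_tmul_tmul_eq (R := k) (Repr.arbitrary k x)
    (fun i => Repr.arbitrary k _) (fun i => Repr.arbitrary k _))
  simp only [map_sum] at h
  exact h


theorem sw_sw_antipode_mul (x : H) (g : H →ₗ[k] M) :
    (sw k x fun a b => sw k b fun c d => g (antipode k a * c) ⊗ₜ[k] d) = g 1 ⊗ₜ[k] x := by
  calc _ = sw k x fun p d => sw k p fun a c => g (antipode k a * c) ⊗ₜ[k] d := (sw_assoc {} x).symm
    _ = sw k x fun p d => counit (R := k) p • (g 1 ⊗ₜ[k] d) := by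
      refine Finset.sum_congr rfl fun i _ => ?_
      dsimp only
      rw [← sw_tmul, ← map_sw, sw_antipode_mul, map_smul, TensorProduct.smul_tmul']
    _ = _ := sw_counit_left (TensorProduct.mk k M H (g 1)) x

end Sweedler

/-! ### The antipode reverses the comultiplication -/

section Antipode

open Coalgebra HopfAlgebra

variable {k : Type*} [Field k] {H : Type*} [Ring H] [HopfAlgebra k H]

/-- In the convolution algebra `Hom(H, H ⊗ H)`, `Δ ∘ S` is a right inverse of `Δ` (`h1`) and the
flipped map `G` is a left inverse (`h2`), so they coincide. -/
theorem comul_antipode (x : H) :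
    comul (antipode k x) = sw k x fun a b => antipode k b ⊗ₜ[k] antipode k a := by
  let G : H →ₗ[k] H ⊗[k] H := TensorProduct.map (antipode k) (antipode k) ∘ₗ
    (TensorProduct.comm k H H).toLinearMap ∘ₗ comul
  have hG (y : H) : G y = sw k y fun a b => antipode k b ⊗ₜ[k] antipode k a := by
    simp only [G, LinearMap.comp_apply]
    rw [← sw_tensor y, map_sw, map_sw]
    rfl
  have h1 (r : H) : (sw k r fun c d => comul c * comul (antipode k d)) =
      counit (R := k) r • (1 : H ⊗[k] H) := by
    rw [← Bialgebra.comul_one (R := k) (A := H), ← map_smul, ← sw_mul_antipode, map_sw]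
    simp only [Bialgebra.comul_mul]
  have h2 (r : H) : (sw k r fun p c => G p * comul c) =
      counit (R := k) r • (1 : H ⊗[k] H) := by
    calc _ = sw k r fun p c => sw k p fun a b => (antipode k b ⊗ₜ[k] antipode k a) * comul c :=
          sw_congr fun p c => by rw [hG, sw_mul_right]
      _ = sw k r fun a q => sw k q fun b c => (antipode k b ⊗ₜ[k] antipode k a) * comul c :=
          sw_assoc {} r
      _ = sw k r fun a q => 1 ⊗ₜ[k] (antipode k a * q) := by
          refine sw_congr fun a q => ?_
          have h := congrArg (LinearMap.lTensor H (LinearMap.mulLeft k (antipode k a)))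
            (sw_sw_antipode_mul q (LinearMap.id (R := k) (M := H)))
          rw [map_sw] at h
          simp only [map_sw, LinearMap.lTensor_tmul, LinearMap.mulLeft_apply,
            LinearMap.id_apply] at h
          rw [← h]
          refine sw_congr fun b c => ?_
          rw [← sw_tensor c, mul_sw]
          simp only [Algebra.TensorProduct.tmul_mul_tmul]
      _ = _ := by
          rw [← tmul_sw, sw_antipode_mul, TensorProduct.tmul_smul]
          rfl
  calc comul (antipode k x)
      = sw k x fun q d => counit (R := k) q • comul (antipode k d) :=
        (sw_counit_left (comul ∘ₗ antipode k) x).symm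
    _ = sw k x fun q d => sw k q fun p c => G p * comul c * comul (antipode k d) :=
        sw_congr fun q d => by rw [← sw_mul_right, h2, smul_mul_assoc, one_mul]
    _ = sw k x fun p r => sw k r fun c d => G p * comul c * comul (antipode k d) := sw_assoc {} x
    _ = sw k x fun p r => counit (R := k) r • G p :=
        sw_congr fun p r => by
          simp only [mul_assoc]
          rw [← mul_sw, h1, mul_smul_comm, mul_one]
    _ = _ := by rw [sw_counit_right, hG]

theorem sw_antipode {M : Type*} [AddCommGroup M] [Module k M] {f : H → H → M} (hf : IsBilin k f)
    (x : H) : sw k (antipode k x) f = sw k x fun a b => f (antipode k b) (antipode k a) :=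
  sw_of_comul_sw hf _ _ _ _ (comul_antipode x)

theorem antipode_sq_mul (x y : H) :
    antipode k (antipode k (x * y)) = antipode k (antipode k x) * antipode k (antipode k y) := by
  simp only [antipode_mul_antidistrib]

theorem sw_antipode_sq {M : Type*} [AddCommGroup M] [Module k M] {f : H → H → M}
    (hf : IsBilin k f) (x : H) : sw k (antipode k (antipode k x)) f =
      sw k x fun a b => f (antipode k (antipode k a)) (antipode k (antipode k b)) := by
  rw [sw_antipode hf, sw_antipode]
  have := hf
  obtain ⟨h1, h2, h3, h4⟩ := this
  exact ⟨fun _ _ _ => by rw [map_add, h3], fun _ _ _ => by rw [map_smul, h4],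
    fun _ _ _ => by rw [map_add, h1], fun _ _ _ => by rw [map_smul, h2]⟩

end Antipode

/-! ### Nondegeneracy of the form `α(xy)` -/

section DualIntegral

open Coalgebra HopfAlgebra

variable {k : Type*} [Field k] {H : Type*} [Ring H] [HopfAlgebra k H]

theorem isLeftIntegralOfDual_iff {α : Module.Dual k H} :
    IsLeftIntegralOfDual α ↔ ∀ h : H, (sw k h fun a b => α b • a) = α h • (1 : H) := by
  refine forall_congr' fun h => ?_
  rw [← sw_tensor h, map_sw, ← LinearEquiv.coe_toLinearMap, map_sw,
    Algebra.algebraMap_eq_smul_one]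
  simp

/-- The identity `∑ y₁ α(x y₂) = ∑ S(x₁) α(x₂ y)`. -/
theorem IsLeftIntegralOfDual.sw_eq {α : Module.Dual k H} (hα : IsLeftIntegralOfDual α) (x y : H) :
    (sw k y fun c d => α (x * d) • c) = sw k x fun a b => α (b * y) • antipode k a := by
  rw [isLeftIntegralOfDual_iff] at hα
  symm
  calc (sw k x fun a b => α (b * y) • antipode k a)
      = sw k x fun a b => sw k b fun c d => sw k y fun e f =>
          α (d * f) • (antipode k a * c * e) := by
        refine sw_congr fun a b => ?_
        rw [← mul_one (antipode k a), ← mul_smul_comm, ← hα, sw_mul {}, mul_sw]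
        refine sw_congr fun c d => ?_
        rw [mul_sw]
        exact sw_congr fun e f => by rw [mul_smul_comm, mul_one, mul_assoc]
    _ = sw k x fun p d => sw k p fun a c => sw k y fun e f =>
          α (d * f) • (antipode k a * c * e) := (sw_assoc {} x).symm
    _ = sw k x fun p d => counit (R := k) p • sw k y fun e f => α (d * f) • e := by
        refine sw_congr fun p d => ?_
        rw [sw_swap (f := fun a c e f => α (d * f) • (antipode k a * c * e)), smul_sw]
        refine sw_congr fun e f => ?_
        rw [← smul_sw, ← sw_mul_right, sw_antipode_mul, smul_mul_assoc, one_mul, smul_comm]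
    _ = _ := by
        simp only [smul_sw]
        rw [sw_swap (f := fun p d e f => counit (R := k) p • α (d * f) • e)]
        refine sw_congr fun e f => ?_
        exact sw_counit_left ((α ∘ₗ LinearMap.mulRight k f).smulRight e) x

/-- The `y` with `α(Hy) = 0` form a left ideal, stable under `y ↦ ∑ φ(y₁)y₂` by `sw_eq`. For `z` in
it, `∑ S(z₁)z₂ = ε(z)1` is in it too, so `α ≠ 0` forces `ε(z) = 0`. Taking `z = ∑ φ(y₁)y₂` gives
`φ(y) = 0` for all `φ`. -/
theorem IsLeftIntegralOfDual.eq_zero_of_right {α : Module.Dual k H} (hα : IsLeftIntegralOfDual α)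
    (hα0 : α ≠ 0) {y : H} (hy : ∀ x, α (x * y) = 0) : y = 0 := by
  have key (z : H) (hz : ∀ x, α (x * z) = 0) (φ : Module.Dual k H) (x : H) :
      α (x * sw k z fun c d => φ c • d) = 0 := by
    have h := congrArg φ (hα.sw_eq x z)
    rw [map_sw, map_sw] at h
    rw [mul_sw, map_sw]
    calc _ = sw k z fun c d => φ (α (x * d) • c) := sw_congr fun c d => by
          simp [mul_comm]
      _ = _ := by rw [h]; simp [hz, sw_zero]
  have hε (z : H) (hz : ∀ x, α (x * z) = 0) : counit (R := k) z = 0 := by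
    by_contra hne
    refine hα0 (LinearMap.ext fun x => ?_)
    let b := Module.Basis.ofVectorSpace k H
    have h1 : α (x * sw k z fun c d => antipode k c * d) = 0 := by
      have h2 (c : H) : antipode k c = (b.repr c).sum fun i r => r • antipode k (b i) := by
        conv_lhs => rw [← b.linearCombination_repr c, Finsupp.linearCombination_apply]
        rw [Finsupp.sum, map_sum]
        simp [Finsupp.sum]
      classical
      -- A finite set of basis indices containing the supports of all left legs of `Δ(z)`; it lets
      -- the two sums be exchanged.
      let s := (Repr.arbitrary k z).index.biUnion
        fun i => (b.repr ((Repr.arbitrary k z).left i)).support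
      have h3 : (sw k z fun c d => antipode k c * d) =
          sw k z fun c d => ∑ i ∈ s, antipode k (b i) * (b.coord i c • d) := by
        refine Finset.sum_congr rfl fun j hj => ?_
        dsimp only
        rw [h2, Finsupp.sum_of_support_subset (s := s), Finset.sum_mul]
        · simp
        · exact Finset.subset_biUnion_of_mem
            (fun i => (b.repr ((Repr.arbitrary k z).left i)).support) hj
        · simp
      rw [h3, sw_sum, Finset.mul_sum, map_sum]
      refine Finset.sum_eq_zero fun i _ => ?_
      rw [← mul_sw, ← mul_assoc]
      exact key z hz _ _
    rw [sw_antipode_mul, mul_smul_comm, mul_one, map_smul, smul_eq_mul] at h1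
    simpa [hne] using h1
  rw [← Module.forall_dual_apply_eq_zero_iff k]
  intro φ
  have h := hε _ (key y hy φ)
  rw [map_sw] at h
  rw [← h, ← sw_counit_right φ y]
  exact sw_congr fun a b => by simp [mul_comm]

variable [Module.Finite k H]

theorem IsLeftIntegralOfDual.exists_right {α : Module.Dual k H} (hα : IsLeftIntegralOfDual α)
    (hα0 : α ≠ 0) (φ : Module.Dual k H) : ∃ w, ∀ x, φ x = α (x * w) := by
  let D : H →ₗ[k] Module.Dual k H := (LinearMap.mul k H).flip.compr₂ α
  have hD : Function.Injective D := (injective_iff_map_eq_zero D).2 fun y hy =>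
    hα.eq_zero_of_right hα0 fun x => LinearMap.congr_fun hy x
  obtain ⟨w, hw⟩ := (LinearMap.injective_iff_surjective_of_finrank_eq_finrank
    (Subspace.dual_finrank_eq).symm).1 hD φ
  exact ⟨w, fun x => (LinearMap.congr_fun hw x).symm⟩

theorem IsLeftIntegralOfDual.eq_zero_of_left {α : Module.Dual k H} (hα : IsLeftIntegralOfDual α)
    (hα0 : α ≠ 0) {w : H} (hw : ∀ x, α (w * x) = 0) : w = 0 := by
  rw [← Module.forall_dual_apply_eq_zero_iff k]
  intro φ
  obtain ⟨u, hu⟩ := hα.exists_right hα0 φ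
  rw [hu, hw]

end DualIntegral

/-! ### Radford's formulas for a normalised pair of integrals -/

section IntegralPair

open Coalgebra HopfAlgebra

variable {k : Type*} [Field k] {H : Type*} [Ring H] [HopfAlgebra k H]

/-- The square of the antipode, as a linear map. -/
abbrev antipodeSq (k : Type*) [Field k] (H : Type*) [Ring H]
    [HopfAlgebra k H] : H →ₗ[k] H := antipode k ∘ₗ antipode k

/-- A left integral `α` of `H*` and a two-sided integral `Λ` of `H` with `ε(Λ) = 1 = α(Λ)`. -/
structure IsIntegralPair (α : Module.Dual k H) (Λ : H) : Prop where
  dual : IsLeftIntegralOfDual α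
  left : ∀ h : H, h * Λ = counit (R := k) h • Λ
  right : ∀ h : H, Λ * h = counit (R := k) h • Λ
  counit_eq : counit (R := k) Λ = 1
  apply_eq : α Λ = 1

namespace IsIntegralPair

variable {α : Module.Dual k H} {Λ : H}

theorem ne_zero (h : IsIntegralPair α Λ) : α ≠ 0 := by
  rintro rfl
  simpa using h.apply_eq

theorem antipode_eq (h : IsIntegralPair α Λ) (x : H) :
    (sw k Λ fun c d => α (x * d) • c) = antipode k x := by
  rw [h.dual.sw_eq, ← sw_counit_right (antipode k) x]
  exact sw_congr fun a b => by rw [h.left, map_smul, h.apply_eq, smul_eq_mul, mul_one]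

/-- Together with `sw_eq'` this says that `S(Λ₁)` and `Λ₂` are dual bases for the form `α(xy)`. -/
theorem eq_sw (h : IsIntegralPair α Λ) (y : H) :
    (sw k Λ fun a b => α (b * y) • antipode k a) = y := by
  rw [← h.dual.sw_eq]
  conv_rhs => rw [← LinearMap.id_apply (R := k) y, ← sw_counit_right (LinearMap.id (R := k)) y]
  exact sw_congr fun a b => by
    rw [h.right, map_smul, h.apply_eq, smul_eq_mul, mul_one, LinearMap.id_apply]

theorem antipode_surjective (h : IsIntegralPair α Λ) : Function.Surjective (antipode k (A := H)) :=
  fun y => ⟨sw k Λ fun a b => α (b * y) • a, by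
    conv_rhs => rw [← h.eq_sw y]
    rw [map_sw]
    exact sw_congr fun a b => map_smul _ _ _⟩

/-- `ΛS(Λ)` is `Λ` because `Λ` is a right integral, and `S(Λ)` because `Λ = S(y)` gives `ΛS(Λ) =
S(Λy)`. -/
theorem antipode_integral (h : IsIntegralPair α Λ) : antipode k Λ = Λ := by
  have h1 : Λ * antipode k Λ = Λ := by
    rw [h.right, counit_antipode, h.counit_eq, one_smul]
  obtain ⟨y, hy⟩ := h.antipode_surjective Λ
  have h2 : Λ * antipode k Λ = antipode k Λ := by
    have h3 : counit (R := k) y = 1 := by rw [← counit_antipode, hy, h.counit_eq]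
    calc Λ * antipode k Λ = antipode k y * antipode k Λ := by rw [hy]
      _ = antipode k Λ := by rw [← antipode_mul_antidistrib, h.right, h3, one_smul]
  rw [← h2, h1]

variable [Module.Finite k H]

theorem antipode_bijective (h : IsIntegralPair α Λ) : Function.Bijective (antipode k (A := H)) :=
  ⟨LinearMap.injective_iff_surjective.2 h.antipode_surjective, h.antipode_surjective⟩

/-- The Nakayama automorphism of `α` is the square of the antipode. -/
theorem apply_mul (h : IsIntegralPair α Λ) (x y : H) :
    α (x * y) = α (y * antipode k (antipode k x)) := by
  obtain ⟨w, hw⟩ := h.dual.exists_right h.ne_zero (α ∘ₗ LinearMap.mulLeft k x)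
  have h1 : antipode k (antipode k x) = w := by
    rw [← h.antipode_eq x, map_sw, ← h.eq_sw w]
    refine sw_congr fun a b => ?_
    rw [map_smul, ← hw]
    rfl
  rw [h1, ← hw]
  rfl

theorem sw_eq' (h : IsIntegralPair α Λ) (w : H) :
    (sw k Λ fun a b => α (w * antipode k a) • b) = w := by
  rw [← sub_eq_zero]
  refine h.dual.eq_zero_of_left h.ne_zero fun y => ?_
  rw [sub_mul, map_sub, sub_eq_zero, sw_mul_right, map_sw]
  conv_rhs => rw [← h.eq_sw y, mul_sw, map_sw]
  refine sw_congr fun a b => ?_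
  rw [smul_mul_assoc, map_smul, mul_smul_comm, map_smul, smul_eq_mul, smul_eq_mul, mul_comm]

/-- Left integrals of `H*` are unique up to scalars. -/
theorem eq_smul_of_isLeftIntegral (h : IsIntegralPair α Λ) {f : Module.Dual k H}
    (hf : IsLeftIntegralOfDual f) : f = f Λ • α := by
  ext w
  have h1 := hf.sw_eq Λ 1
  rw [sw_one {}] at h1
  conv_lhs => rw [← h.sw_eq' w, map_sw]
  calc _ = sw k Λ fun a b => α (w * (f (b * 1) • antipode k a)) := sw_congr fun a b => by
        rw [map_smul, mul_one, mul_smul_comm, map_smul, smul_eq_mul, smul_eq_mul, mul_comm]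
    _ = α (w * sw k Λ fun a b => f (b * 1) • antipode k a) := by rw [mul_sw, map_sw]
    _ = _ := by rw [← h1]; simp

theorem trace_eq (h : IsIntegralPair α Λ) (F : H →ₗ[k] H) :
    LinearMap.trace k H F = sw k Λ fun a b => α (b * F (antipode k a)) := by
  have h1 : F = sw k Λ fun a b => (α ∘ₗ LinearMap.mulLeft k b).smulRight (F (antipode k a)) := by
    ext y
    conv_lhs => rw [← h.eq_sw y, map_sw]
    rw [sw, sw, LinearMap.sum_apply]
    simp
  conv_lhs => rw [h1]
  rw [map_sw]
  exact sw_congr fun a b => LinearMap.trace_smulRight _ _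

/-- In `trace_eq` the Nakayama automorphism moves `Λ₂` to the right as `S²(Λ₂)`, and `S(Λ₁)Λ₂`
collapses to `ε(Λ) = 1`. -/
theorem trace_mulLeft_antipodeSq (h : IsIntegralPair α Λ) (x : H) :
    LinearMap.trace k H (LinearMap.mulLeft k x ∘ₗ antipodeSq k H) = α x := by
  rw [h.trace_eq]
  calc _ = sw k Λ fun a b => α (x * antipode k (antipode k (antipode k a * b))) :=
        sw_congr fun a b => by
          rw [h.apply_mul, antipode_sq_mul, ← mul_assoc]
          rfl
    _ = α (x * antipode k (antipode k (sw k Λ fun a b => antipode k a * b))) := by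
        simp only [map_sw, mul_sw]
    _ = _ := by rw [sw_antipode_mul, h.counit_eq]; simp

theorem trace_antipodeSq (h : IsIntegralPair α Λ) :
    LinearMap.trace k H (antipodeSq k H) = α 1 := by
  rw [← h.trace_mulLeft_antipodeSq 1, LinearMap.mulLeft_one, LinearMap.id_comp]

/-- The distinguished group-like element of `H`. -/
noncomputable def distinguished (α : Module.Dual k H) (Λ : H) : H := sw k Λ fun a b => α a • b

/-- For every `φ` the convolution product `α * φ` is again a left integral of `H*`, hence a multiple
of `α`; its value at `Λ` is `φ` of the distinguished element. -/
theorem sw_apply_smul (h : IsIntegralPair α Λ) (x : H) :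
    (sw k x fun a b => α a • b) = α x • distinguished α Λ := by
  rw [← sub_eq_zero, ← Module.forall_dual_apply_eq_zero_iff k]
  intro φ
  let f : Module.Dual k H := TensorProduct.lift (LinearMap.mul k k ∘ₗ α |>.compl₂ φ) ∘ₗ comul
  have hf (y : H) : f y = sw k y fun a b => α a * φ b := by
    rw [show f y = TensorProduct.lift _ (comul y) from rfl, ← sw_tensor y, map_sw]
    rfl
  have h1 : IsLeftIntegralOfDual f := by
    rw [isLeftIntegralOfDual_iff]
    intro y
    calc _ = sw k y fun p q => sw k q fun a b => (α a * φ b) • p :=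
          sw_congr fun p q => by rw [hf, sw_smul_right]
      _ = sw k y fun q b => sw k q fun p a => (α a * φ b) • p := (sw_assoc {} y).symm
      _ = sw k y fun q b => (α q * φ b) • (1 : H) := sw_congr fun q b => by
          rw [mul_comm, mul_smul, ← (isLeftIntegralOfDual_iff.1 h.dual q), smul_sw]
          exact sw_congr fun c d => by rw [mul_comm, mul_smul]
      _ = _ := by rw [hf, sw_smul_right]
  have h2 := LinearMap.congr_fun (h.eq_smul_of_isLeftIntegral h1) x
  rw [map_sub, sub_eq_zero, map_sw, map_smul, distinguished, map_sw]
  simp only [map_smul, smul_eq_mul, LinearMap.smul_apply, hf] at h2 ⊢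
  rw [h2, mul_comm]

theorem isGroupLikeElem_distinguished (h : IsIntegralPair α Λ) :
    IsGroupLikeElem k (distinguished α Λ) where
  counit_eq_one := by
    rw [distinguished, map_sw, ← h.apply_eq]
    conv_rhs => rw [← sw_counit_right α Λ]
    exact sw_congr fun a b => by rw [map_smul, smul_eq_mul, smul_eq_mul, mul_comm]
  comul_eq_tmul_self := by
    calc comul (distinguished α Λ)
        = sw k Λ fun a b => sw k b fun c d => α a • (c ⊗ₜ[k] d) := by
          rw [distinguished, map_sw]
          exact sw_congr fun a b => by rw [map_smul, ← sw_tensor b, smul_sw]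
      _ = sw k Λ fun q d => sw k q fun a c => α a • (c ⊗ₜ[k] d) := (sw_assoc {} Λ).symm
      _ = sw k Λ fun q d => α q • (distinguished α Λ ⊗ₜ[k] d) := sw_congr fun q d => by
          simp only [TensorProduct.smul_tmul']
          rw [← sw_tmul, h.sw_apply_smul]
      _ = _ := by
          simp only [← TensorProduct.tmul_smul]
          rw [← tmul_sw]
          rfl

/-- By `h1`, `α ∘ S` is a left integral twisted by `g⁻¹ = S(g)`. Precomposing with multiplication by
`g⁻¹` removes the twist and gives a left integral of value 1 at `Λ`, which is `α` by uniqueness. -/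
theorem apply_antipode (h : IsIntegralPair α Λ) (x : H) :
    α (antipode k x) = α (distinguished α Λ * x) := by
  set g := distinguished α Λ with hg
  have hgl : IsGroupLikeElem k g := h.isGroupLikeElem_distinguished
  have h1 (y : H) : (sw k y fun a b => α (antipode k b) • a) = α (antipode k y) • antipode k g := by
    apply h.antipode_bijective.1
    rw [map_smul, hgl.antipode_antipode, hg, ← h.sw_apply_smul, sw_antipode {}, map_sw]
    exact sw_congr fun a b => map_smul _ _ _
  let f : Module.Dual k H := α ∘ₗ antipode k ∘ₗ LinearMap.mulLeft k (antipode k g)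
  have hcomul : comul (antipode k g) = antipode k g ⊗ₜ[k] antipode k g :=
    hgl.antipode.comul_eq_tmul_self
  have hf : IsLeftIntegralOfDual f := by
    rw [isLeftIntegralOfDual_iff]
    intro y
    have h2 := congrArg (g * ·) (h1 (antipode k g * y))
    rw [sw_groupLike_mul {} hcomul, mul_sw, mul_smul_comm, hgl.mul_antipode_cancel] at h2
    rw [show f y = α (antipode k (antipode k g * y)) from rfl, ← h2]
    refine sw_congr fun a b => ?_
    rw [mul_smul_comm, ← mul_assoc, hgl.mul_antipode_cancel, one_mul]
    rfl
  have h3 := LinearMap.congr_fun (h.eq_smul_of_isLeftIntegral hf) (g * x)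
  have h4 : f Λ = 1 := by
    change α (antipode k (antipode k g * Λ)) = 1
    rw [h.left, hgl.antipode.counit_eq_one, one_smul, h.antipode_integral, h.apply_eq]
  rw [h4, one_smul] at h3
  rw [← h3]
  change _ = α (antipode k (antipode k g * (g * x)))
  rw [← mul_assoc, hgl.antipode_mul_cancel, one_mul]

/-- Group-like elements are linearly independent, so in finite dimension they form a finite group.
-/
theorem exists_distinguished_pow_eq_one (h : IsIntegralPair α Λ) :
    ∃ N, 0 < N ∧ distinguished α Λ ^ N = 1 := by
  set g : GroupLike k H := ⟨distinguished α Λ, h.isGroupLikeElem_distinguished⟩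
  have : Finite (GroupLike k H) := (linearIndep_groupLikeVal (R := k) (A := H)).finite
  obtain ⟨N, hN, h1⟩ := isOfFinOrder_iff_pow_eq_one.1 (isOfFinOrder_of_finite g)
  exact ⟨N, hN, congrArg GroupLike.val h1⟩

theorem distinguished_eq_one (h : IsIntegralPair α Λ) (h1 : α 1 ≠ 0) : distinguished α Λ = 1 := by
  have h2 := h.sw_apply_smul 1
  rw [sw_one {}] at h2
  exact (smul_right_injective H h1 h2).symm

end IsIntegralPair
end IntegralPair

/-! ### The regular character and the square of the antipode -/

section RegularCharacter

open Coalgebra HopfAlgebra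

theorem trace_eq_of_comp_eq {k V W : Type*} [Field k] [AddCommGroup V] [Module k V]
    [AddCommGroup W] [Module k W] {e : V →ₗ[k] W} (he : Function.Bijective e)
    {F : W →ₗ[k] W} {G : V →ₗ[k] V} (h : F ∘ₗ e = e ∘ₗ G) :
    LinearMap.trace k W F = LinearMap.trace k V G := by
  rw [← LinearMap.trace_conj' G (LinearEquiv.ofBijective e he)]
  congr 1
  ext w
  obtain ⟨v, rfl⟩ := he.2 w
  have h1 : (LinearEquiv.ofBijective e he).symm (e v) = v :=
    (LinearEquiv.ofBijective e he).symm_apply_apply v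
  rw [LinearEquiv.conj_apply, LinearMap.comp_apply, LinearMap.comp_apply,
    LinearEquiv.coe_coe, LinearEquiv.coe_coe, h1]
  exact LinearMap.congr_fun h v

variable (k : Type*) [Field k] (H : Type*) [Ring H]

/-- The character of the regular representation. -/
noncomputable def regularChar [Algebra k H] : Module.Dual k H :=
  LinearMap.trace k H ∘ₗ LinearMap.mul k H

variable {k H}

theorem regularChar_apply [Algebra k H] (x : H) :
    regularChar k H x = LinearMap.trace k H (LinearMap.mulLeft k x) := rfl

theorem regularChar_mul_comm [Algebra k H] (x y : H) :
    regularChar k H (x * y) = regularChar k H (y * x) := by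
  rw [regularChar_apply, regularChar_apply, LinearMap.mulLeft_mul, LinearMap.mulLeft_mul]
  exact LinearMap.trace_mul_comm k _ _

/-- The trace form of `H` is nondegenerate. -/
def IsTraceNondegenerate (k H : Type*) [Field k] [Ring H] [Algebra k H] : Prop :=
  ∀ w : H, (∀ x, regularChar k H (w * x) = 0) → w = 0

theorem IsTraceNondegenerate.exists_eq [Algebra k H] [Module.Finite k H]
    (hn : IsTraceNondegenerate k H) (φ : Module.Dual k H) :
    ∃ w, ∀ x, φ x = regularChar k H (w * x) := by
  let D : H →ₗ[k] Module.Dual k H := (LinearMap.mul k H).compr₂ (regularChar k H)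
  have hD : Function.Injective D := (injective_iff_map_eq_zero D).2 fun y hy =>
    hn y fun x => LinearMap.congr_fun hy x
  obtain ⟨w, hw⟩ := (LinearMap.injective_iff_surjective_of_finrank_eq_finrank
    (Subspace.dual_finrank_eq).symm).1 hD φ
  exact ⟨w, fun x => (LinearMap.congr_fun hw x).symm⟩

/-- The trace form identifies `H` with `H*` and carries right multiplication by `x` to the transpose
of left multiplication by `x`. -/
theorem IsTraceNondegenerate.trace_mulRight [Algebra k H] [Module.Finite k H]
    (hn : IsTraceNondegenerate k H) (x : H) :
    LinearMap.trace k H (LinearMap.mulRight k x) = regularChar k H x := by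
  let D : H →ₗ[k] Module.Dual k H := (LinearMap.mul k H).compr₂ (regularChar k H)
  have hD : Function.Injective D := (injective_iff_map_eq_zero D).2 fun y hy =>
    hn y fun x => LinearMap.congr_fun hy x
  have hD' : Function.Bijective D := ⟨hD, (LinearMap.injective_iff_surjective_of_finrank_eq_finrank
    (Subspace.dual_finrank_eq).symm).1 hD⟩
  rw [regularChar_apply, ← LinearMap.trace_transpose' (LinearMap.mulLeft k x)]
  symm
  refine trace_eq_of_comp_eq hD' ?_
  ext w y
  change regularChar k H (w * (x * y)) = regularChar k H (w * x * y)
  rw [mul_assoc]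

variable [HopfAlgebra k H]

variable (k H) in
/-- Convolution with the regular character: `y ↦ ∑ y₁ χ(y₂)`. -/
noncomputable def regularConv : H →ₗ[k] H :=
  (TensorProduct.rid k H).toLinearMap ∘ₗ LinearMap.lTensor H (regularChar k H) ∘ₗ comul

theorem regularConv_apply (y : H) :
    regularConv k H y = sw k y fun a b => regularChar k H b • a := by
  simp only [regularConv, LinearMap.comp_apply]
  rw [← sw_tensor y, map_sw, map_sw]
  rfl

variable [Module.Finite k H]

/-- `Φ : h ⊗ z ↦ Δ(h)(1 ⊗ z)` is an isomorphism from `H ⊗ H` with action on the first factor to `H ⊗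
H` with diagonal action; compare traces. Its inverse is `Ψ : h ⊗ z ↦ ∑ h₁ ⊗ S(h₂)z`. -/
theorem sw_regularChar_mul (y : H) :
    (sw k y fun a b => regularChar k H a * regularChar k H b) =
      Module.finrank k H * regularChar k H y := by
  let Φ : H ⊗[k] H →ₗ[k] H ⊗[k] H := TensorProduct.lift
    (((LinearMap.mul k (H ⊗[k] H)).compl₂ (TensorProduct.mk k H H 1)) ∘ₗ comul)
  have hΦ (h z : H) : Φ (h ⊗ₜ z) = comul h * (1 ⊗ₜ[k] z) := rfl
  let Ψ : H ⊗[k] H →ₗ[k] H ⊗[k] H := (LinearMap.lTensor H (LinearMap.mul' k H)) ∘ₗ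
    (TensorProduct.assoc k H H H).toLinearMap ∘ₗ
    LinearMap.rTensor H (LinearMap.lTensor H (antipode k) ∘ₗ comul)
  have hΨ (h z : H) : Ψ (h ⊗ₜ z) = sw k h fun a b => a ⊗ₜ[k] (antipode k b * z) := by
    simp only [Ψ, LinearMap.comp_apply, LinearMap.rTensor_tmul]
    rw [← sw_tensor h]
    simp only [map_sw, sw_tmul]
    rfl
  have h1 : Φ * Ψ = 1 := by
    refine TensorProduct.ext' fun h z => ?_
    rw [Module.End.mul_apply, hΨ, map_sw]
    calc _ = sw k h fun a b => sw k a fun c d => c ⊗ₜ[k] (d * antipode k b * z) :=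
          sw_congr fun a b => by
            rw [hΦ, ← sw_tensor a, sw_mul_right]
            simp only [Algebra.TensorProduct.tmul_mul_tmul, mul_one, mul_assoc]
      _ = sw k h fun c q => sw k q fun d b => c ⊗ₜ[k] (d * antipode k b * z) := sw_assoc {} h
      _ = sw k h fun c q => counit (R := k) q • (c ⊗ₜ[k] z) := sw_congr fun c q => by
            rw [← tmul_sw, ← sw_mul_right, sw_mul_antipode, smul_mul_assoc, one_mul,
              TensorProduct.tmul_smul]
      _ = _ := sw_counit_right ((TensorProduct.mk k H H).flip z) h
  have h2 : Function.Bijective Φ := Function.bijective_iff_has_inverse.2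
    ⟨Ψ, LinearMap.congr_fun (mul_eq_one_comm.1 h1), LinearMap.congr_fun h1⟩
  have h3 : (sw k y fun a b => TensorProduct.map (LinearMap.mulLeft k a) (LinearMap.mulLeft k b))
      = LinearMap.mulLeft k (comul (R := k) y) := by
    refine TensorProduct.ext' fun h z => ?_
    rw [sw, LinearMap.sum_apply, LinearMap.mulLeft_apply, ← sw_tensor y, sw_mul_right]
    simp only [Algebra.TensorProduct.tmul_mul_tmul]
    rfl
  have h4 : LinearMap.mulLeft k (comul (R := k) y) ∘ₗ Φ =
      Φ ∘ₗ TensorProduct.map (LinearMap.mulLeft k y) LinearMap.id := by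
    refine TensorProduct.ext' fun h z => ?_
    rw [LinearMap.comp_apply, LinearMap.comp_apply, hΦ, TensorProduct.map_tmul, hΦ,
      LinearMap.mulLeft_apply, LinearMap.mulLeft_apply, Bialgebra.comul_mul, mul_assoc]
    rfl
  have h5 := trace_eq_of_comp_eq h2 h4
  rw [← h3, map_sw, LinearMap.trace_tensorProduct', LinearMap.trace_id] at h5
  rw [mul_comm, regularChar_apply, ← h5]
  exact sw_congr fun a b => (LinearMap.trace_tensorProduct' _ _).symm

theorem regularConv_regularConv (y : H) :
    regularConv k H (regularConv k H y) = (Module.finrank k H : k) • regularConv k H y := by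
  conv_lhs => rw [regularConv_apply y, map_sw]
  calc _ = sw k y fun p q => sw k p fun a b => (regularChar k H b * regularChar k H q) • a :=
        sw_congr fun p q => by
          rw [map_smul, regularConv_apply, smul_sw]
          exact sw_congr fun a b => by rw [smul_smul, mul_comm]
    _ = sw k y fun a r => sw k r fun b q => (regularChar k H b * regularChar k H q) • a :=
        sw_assoc {} y
    _ = sw k y fun a r => (Module.finrank k H : k) • (regularChar k H r • a) :=
        sw_congr fun a r => by rw [← sw_smul_right, sw_regularChar_mul, mul_smul]
    _ = _ := by rw [← smul_sw, ← regularConv_apply]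

namespace IsIntegralPair

variable {α : Module.Dual k H} {Λ : H}

theorem antipodeSq_bijective (h : IsIntegralPair α Λ) : Function.Bijective (antipodeSq k H) :=
  h.antipode_bijective.comp h.antipode_bijective

theorem regularChar_antipodeSq (h : IsIntegralPair α Λ) (x : H) :
    regularChar k H (antipode k (antipode k x)) = regularChar k H x := by
  refine trace_eq_of_comp_eq h.antipodeSq_bijective ?_
  ext y
  exact (antipode_sq_mul x y).symm

theorem regularConv_antipodeSq (h : IsIntegralPair α Λ) (x : H) :
    regularConv k H (antipode k (antipode k x)) = antipode k (antipode k (regularConv k H x)) := by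
  rw [regularConv_apply, regularConv_apply, sw_antipode_sq {}, map_sw, map_sw]
  exact sw_congr fun a b => by rw [h.regularChar_antipodeSq, map_smul, map_smul]

theorem regularChar_integral (h : IsIntegralPair α Λ) : regularChar k H Λ = 1 := by
  have h1 : LinearMap.mulLeft k Λ = (counit (R := k) (A := H)).smulRight Λ := by
    ext y
    simp [h.right]
  rw [regularChar_apply, h1, LinearMap.trace_smulRight, h.counit_eq]

/-- In the trace formula at `Λ` the legs in `α` collapse to `α(1)`, and the remaining factor is
`χ(S(Λ)) = χ(Λ) = 1`, with `χ` the regular character. -/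
theorem trace_regularConv_antipodeSq (h : IsIntegralPair α Λ) :
    LinearMap.trace k H (regularConv k H ∘ₗ antipodeSq k H) =
      LinearMap.trace k H (antipodeSq k H) := by
  have h0 (x : H) : regularChar k H (antipode k (antipode k (antipode k x))) =
      regularChar k H (antipode k x) := h.regularChar_antipodeSq _
  rw [h.trace_antipodeSq, h.trace_eq]
  calc _ = sw k Λ fun a b => sw k a fun c d => regularChar k H (antipode k c) *
          α (antipode k (antipode k (antipode k d * b))) := sw_congr fun a b => by
          simp only [LinearMap.comp_apply]
          rw [regularConv_antipodeSq h, regularConv_apply, sw_antipode {}, map_sw, map_sw, mul_sw,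
            map_sw]
          refine sw_congr fun c d => ?_
          rw [map_smul, map_smul, mul_smul_comm, map_smul, smul_eq_mul, h.apply_mul,
            antipode_sq_mul]
    _ = sw k Λ fun c q => sw k q fun d b => regularChar k H (antipode k c) *
          α (antipode k (antipode k (antipode k d * b))) := sw_assoc {} Λ
    _ = sw k Λ fun c q => counit (R := k) q • (α 1 * regularChar k H (antipode k c)) :=
        sw_congr fun c q => by
          have h1 := congrArg (α ∘ₗ antipode k ∘ₗ antipode k) (sw_antipode_mul (k := k) q)
          rw [map_sw, map_smul] at h1
          simp only [LinearMap.comp_apply, antipode_one] at h1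
          rw [← mul_sw, h1, smul_eq_mul, smul_eq_mul]
          ring
    _ = α 1 * regularChar k H (antipode k Λ) :=
        sw_counit_right (LinearMap.mulLeft k (α 1) ∘ₗ regularChar k H ∘ₗ antipode k) Λ
    _ = α 1 := by rw [h.antipode_integral, h.regularChar_integral, mul_one]

theorem regularChar_antipode (h : IsIntegralPair α Λ) (hn : IsTraceNondegenerate k H) (x : H) :
    regularChar k H (antipode k x) = regularChar k H x := by
  rw [← hn.trace_mulRight]
  refine trace_eq_of_comp_eq (e := antipode k) h.antipode_bijective ?_
  ext y
  exact (antipode_mul_antidistrib x y).symm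

/-- The square of the antipode is inner. -/
theorem exists_antipodeSq_eq_conj (h : IsIntegralPair α Λ) (hn : IsTraceNondegenerate k H) :
    ∃ u : Hˣ, (∀ x : H, antipode k (antipode k x) * u = u * x) ∧
      antipode k (u : H) = u * distinguished α Λ := by
  -- The element `u` is the density of `α` against the regular character; the Nakayama rule for `α`
  -- becomes `S²(x)u = ux`.
  obtain ⟨u, hu⟩ := hn.exists_eq α
  have h1 (x : H) : antipode k (antipode k x) * u = u * x := by
    rw [← sub_eq_zero]
    refine hn _ fun y => ?_
    rw [sub_mul, map_sub, sub_eq_zero, mul_assoc u, ← hu, h.apply_mul, hu, ← mul_assoc u,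
      regularChar_mul_comm _ y, regularChar_mul_comm (u * y), ← mul_assoc,
      regularChar_mul_comm, regularChar_mul_comm _ (u * y), mul_assoc]
  have hunit : IsUnit u := by
    have hinj : Function.Injective (LinearMap.mulLeft k u) :=
      (injective_iff_map_eq_zero _).2 fun x hx => h.dual.eq_zero_of_left h.ne_zero fun y => by
        rw [hu, ← mul_assoc, show u * x = 0 from hx, zero_mul, map_zero]
    obtain ⟨v, hv⟩ := LinearMap.injective_iff_surjective.1 hinj 1
    have hv' : u * v = 1 := hv
    exact ⟨⟨u, v, hv', hinj (by simp [← mul_assoc, hv'])⟩, rfl⟩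
  have h2 : antipode k (antipode k u) = u := hunit.mul_right_cancel (h1 u)
  refine ⟨hunit.unit, h1, ?_⟩
  rw [← sub_eq_zero]
  refine hn _ fun x => ?_
  rw [sub_mul, map_sub, sub_eq_zero, IsUnit.unit_spec, mul_assoc, ← hu, ← h.apply_antipode, hu,
    regularChar_mul_comm, ← h.regularChar_antipode hn, antipode_mul_antidistrib, h2]

/-- Some power of `u` is central. -/
theorem exists_pow_central (h : IsIntegralPair α Λ) {u : Hˣ}
    (hu : ∀ x : H, antipode k (antipode k x) * u = u * x)
    (hu' : antipode k (u : H) = u * distinguished α Λ) :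
    ∃ M, 0 < M ∧ ∀ x : H, (u : H) ^ M * x = x * (u : H) ^ M := by
  obtain ⟨N, hN, hgN⟩ := h.exists_distinguished_pow_eq_one
  set g := distinguished α Λ
  have hug : (u : H) * g = g * u := by
    rw [← hu, h.isGroupLikeElem_distinguished.antipode_antipode]
  -- Applying `S` to `S²(y)u = uy` shows that `S(u)u` is central, and `S(u)u = u²g`.
  have hc (x : H) : ((u : H) ^ 2 * g) * x = x * ((u : H) ^ 2 * g) := by
    obtain ⟨y, rfl⟩ := h.antipode_surjective x
    have h1 := congrArg (antipode k) (hu y)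
    rw [antipode_mul_antidistrib, antipode_mul_antidistrib] at h1
    have h2 : antipode k (u : H) * u = (u : H) ^ 2 * g := by
      rw [hu', mul_assoc, ← hug, ← mul_assoc, pow_two]
    rw [← h2, mul_assoc, ← hu, ← mul_assoc, h1, mul_assoc]
  have hN2 : (u : H) ^ (2 * N) = ((u : H) ^ 2 * g) ^ N := by
    have : Commute ((u : H) ^ 2) g := (show Commute (u : H) g from hug).pow_left 2
    rw [this.mul_pow, hgN, mul_one, pow_mul]
  refine ⟨2 * N, by omega, fun x => ?_⟩
  rw [hN2]
  exact (show Commute ((u : H) ^ 2 * g) x from hc x).pow_left N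

theorem antipode_pow_four (h : IsIntegralPair α Λ) (hn : IsTraceNondegenerate k H)
    (h1 : α 1 ≠ 0) (x : H) : antipode k (antipode k (antipode k (antipode k x))) = x := by
  obtain ⟨u, hu, hu'⟩ := h.exists_antipodeSq_eq_conj hn
  rw [h.distinguished_eq_one h1, mul_one] at hu'
  have h2 := congrArg (antipode k) (hu (antipode k x))
  rw [antipode_mul_antidistrib, antipode_mul_antidistrib, hu', hu] at h2
  exact u.isUnit.mul_left_cancel h2

/-- The involution `T = S²` commutes with the idempotent `E = P/n`, where `n = dim H`, so `tr(ET)`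
is an integer `a - b`. As `tr(PT) = tr(T)`, the nonzero integer `tr(T) = n - 2q` is divisible by
`n`, where `q` is the dimension of the `-1`-eigenspace. So `q` is `0` or `n`, and `T 1 = 1` excludes
`n`. -/
theorem antipodeSq_eq_id [CharZero k] (h : IsIntegralPair α Λ) (hn : IsTraceNondegenerate k H)
    (h1 : α 1 ≠ 0) : antipodeSq k H = LinearMap.id := by
  have : Nontrivial H := ⟨Λ, 0, fun h0 => by simpa [h0] using h.apply_eq⟩
  set T : Module.End k H := antipodeSq k H with hT
  set n := Module.finrank k H with hndef
  have hn0 : (n : k) ≠ 0 := Nat.cast_ne_zero.2 Module.finrank_pos.ne'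
  have hTT : T * T = 1 := LinearMap.ext fun x => h.antipode_pow_four hn h1 x
  let P : Module.End k H := regularConv k H
  have hPP : P * P = (n : k) • P := LinearMap.ext fun x => regularConv_regularConv x
  have hPT : P * T = T * P := LinearMap.ext fun x => h.regularConv_antipodeSq x
  have htr : LinearMap.trace k H (P * T) = LinearMap.trace k H T := h.trace_regularConv_antipodeSq
  have hT0 : LinearMap.trace k H T ≠ 0 := by
    rw [h.trace_antipodeSq]
    exact h1
  have htrace {E : Module.End k H} (hE : IsIdempotentElem E) :
      LinearMap.trace k H E = (Module.finrank k (LinearMap.range E) : k) :=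
    (LinearMap.IsIdempotentElem.isProj_range E hE).trace
  set E : Module.End k H := (n : k)⁻¹ • P with hEdef
  set X : Module.End k H := (n : k)⁻¹ • (P * T) with hXdef
  have hEE : E * E = E := by
    rw [hEdef, smul_mul_smul_comm, hPP, smul_smul, mul_assoc, inv_mul_cancel₀ hn0, mul_one]
  have hET : E * T = X := by rw [hEdef, hXdef, smul_mul_assoc]
  have hTE : T * E = X := by rw [hEdef, hXdef, mul_smul_comm, hPT]
  have hEX : E * X = X := by rw [← hET, ← mul_assoc, hEE]
  have hXE : X * E = X := by rw [← hTE, mul_assoc, hEE]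
  have hXX : X * X = E := by
    calc X * X = T * E * (E * T) := by rw [hTE, hET]
      _ = T * (E * E * T) := by simp only [mul_assoc]
      _ = E := by rw [hEE, hET, ← hTE, ← mul_assoc, hTT, one_mul]
  have h2 : (2 : k) ≠ 0 := two_ne_zero
  -- Used for `Y = X` and `Y = -X`: the projections onto the `±1`-eigenspaces of `T` in the range of
  -- `E`.
  have half (Y : Module.End k H) (hY : Y * Y = E) (hEY : E * Y = Y) (hYE : Y * E = Y) :
      IsIdempotentElem ((2⁻¹ : k) • (E + Y)) := by
    rw [IsIdempotentElem, smul_mul_smul_comm, add_mul, mul_add, mul_add, hEE, hY, hEY, hYE,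
      add_comm Y E, ← two_smul k (E + Y), smul_smul]
    congr 1
    field_simp
  have hX1 := htrace (half X hXX hEX hXE)
  have hX2 := htrace (half (-X) ((neg_mul_neg X X).trans hXX)
    ((mul_neg E X).trans (congrArg _ hEX)) ((neg_mul X E).trans (congrArg _ hXE)))
  have hQ : IsIdempotentElem ((2⁻¹ : k) • (1 - T)) := by
    have h3 : (1 - T) * (1 - T) = (2 : k) • (1 - T) := by
      rw [sub_mul, one_mul, mul_sub, mul_one, hTT]
      module
    rw [IsIdempotentElem, smul_mul_smul_comm, h3, smul_smul]
    congr 1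
    field_simp
  have hQtr := htrace hQ
  set Q := (2⁻¹ : k) • (1 - T) with hQdef
  set a := Module.finrank k (LinearMap.range ((2⁻¹ : k) • (E + X)))
  set b := Module.finrank k (LinearMap.range ((2⁻¹ : k) • (E + -X)))
  set q := Module.finrank k (LinearMap.range Q) with hq
  have hTQ : T = 1 - (2 : k) • Q := by
    rw [hQdef, smul_smul, mul_inv_cancel₀ h2, one_smul, sub_sub_cancel]
  have hTtr : LinearMap.trace k H T = n - 2 * q := by
    rw [hTQ, map_sub, map_smul, hQtr, LinearMap.trace_one, smul_eq_mul]
  have hXtr : LinearMap.trace k H X = a - b := by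
    rw [← hX1, ← hX2, ← map_sub]
    congr 1
    module
  have hmain : ((n : ℤ) - 2 * q : k) = n * ((a : ℤ) - b : k) := by
    rw [hXdef, map_smul, htr, hTtr, smul_eq_mul] at hXtr
    push_cast
    rw [← hXtr, mul_inv_cancel_left₀ hn0]
  have hmain' : (n : ℤ) - 2 * q = n * ((a : ℤ) - b) := by exact_mod_cast hmain
  have hne : (n : ℤ) - 2 * q ≠ 0 := fun h0 => hT0 (by
    rw [hTtr]
    exact_mod_cast congrArg (Int.cast : ℤ → k) h0)
  have hqn : q ≤ n := Submodule.finrank_le _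
  have hq0 : q = 0 ∨ q = n := by
    rcases lt_trichotomy ((a : ℤ) - b) 0 with hm | hm | hm
    · right
      nlinarith [Module.finrank_pos (R := k) (M := H)]
    · rw [hm, mul_zero] at hmain'
      exact absurd hmain' hne
    · left
      nlinarith
  rcases hq0 with hq0 | hq0
  · have hQ0 : Q = 0 := LinearMap.range_eq_bot.1 (Submodule.finrank_eq_zero.1 hq0)
    rw [hTQ, hQ0, smul_zero, sub_zero]
    rfl
  · have hr : LinearMap.range Q = ⊤ := Submodule.eq_top_of_finrank_eq hq0
    obtain ⟨z, hz⟩ := LinearMap.range_eq_top.1 hr 1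
    have h3 : Q 1 = 1 := by
      rw [← hz, ← Module.End.mul_apply, hQ]
    have h4 : T 1 = 1 := by simp [hT]
    rw [hTQ, LinearMap.sub_apply, LinearMap.smul_apply, h3, Module.End.one_apply, sub_eq_self] at h4
    simp [h2] at h4

end IsIntegralPair
end RegularCharacter

/-! ### Traces on products of matrix algebras -/

section Matrices

theorem trace_mulLeft_mulRight_matrix {K m : Type*} [Field K] [Fintype m] [DecidableEq m]
    (a b : Matrix m m K) :
    LinearMap.trace K (Matrix m m K) (LinearMap.mulLeft K a ∘ₗ LinearMap.mulRight K b) =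
      a.trace * b.trace := by
  rw [LinearMap.trace_eq_matrix_trace K (Matrix.stdBasis K m m), Matrix.trace, Matrix.trace,
    Matrix.trace, Finset.sum_mul_sum, Fintype.sum_prod_type]
  refine Finset.sum_congr rfl fun i _ => Finset.sum_congr rfl fun j _ => ?_
  have h1 (x : Matrix m m K) : (Matrix.stdBasis K m m).repr x (i, j) = x i j := rfl
  rw [Matrix.diag_apply, LinearMap.toMatrix_apply, h1, Matrix.stdBasis_eq_single]
  simp [Matrix.mul_apply, Matrix.single_apply, Finset.sum_ite_eq, ite_and]

theorem trace_pi {K ι : Type*} [Field K] [Fintype ι] [DecidableEq ι] {V : ι → Type*}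
    [∀ i, AddCommGroup (V i)] [∀ i, Module K (V i)] [∀ i, Module.Finite K (V i)]
    (F : ∀ i, V i →ₗ[K] V i) :
    LinearMap.trace K (∀ i, V i) (LinearMap.pi fun i => F i ∘ₗ LinearMap.proj i) =
      ∑ i, LinearMap.trace K (V i) (F i) := by
  have h1 : (LinearMap.pi fun i => F i ∘ₗ LinearMap.proj i : (∀ i, V i) →ₗ[K] ∀ i, V i) =
      ∑ i, LinearMap.single K V i ∘ₗ (F i ∘ₗ LinearMap.proj i) := by
    refine LinearMap.ext fun x => funext fun j => ?_
    rw [LinearMap.sum_apply, Finset.sum_apply, Finset.sum_eq_single j]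
    · simp
    · intro i _ hij
      simp [Pi.single_eq_of_ne hij.symm]
    · simp
  rw [h1, map_sum]
  refine Finset.sum_congr rfl fun i _ => ?_
  rw [LinearMap.trace_comp_comm', LinearMap.comp_assoc, LinearMap.proj_comp_single_same,
    LinearMap.comp_id]

theorem trace_mulLeft_mulRight_of_algEquiv {K H : Type*} [Field K] [Ring H] [Algebra K H]
    {n : ℕ} {d : Fin n → ℕ} (e : H ≃ₐ[K] ∀ i, Matrix (Fin (d i)) (Fin (d i)) K) (a b : H) :
    LinearMap.trace K H (LinearMap.mulLeft K a ∘ₗ LinearMap.mulRight K b) =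
      ∑ i, (e a i).trace * (e b i).trace := by
  simp only [← trace_mulLeft_mulRight_matrix]
  rw [← trace_pi]
  symm
  refine trace_eq_of_comp_eq (e := e.toLinearMap) e.bijective ?_
  ext x i : 2
  simp

/-- The regular character is `∑ d_i tr_i`, and the `d_i` are nonzero in characteristic 0. -/
theorem isTraceNondegenerate_of_algEquiv {K H : Type*} [Field K] [CharZero K] [Ring H]
    [Algebra K H] {n : ℕ} {d : Fin n → ℕ} (hd : ∀ i, NeZero (d i))
    (e : H ≃ₐ[K] ∀ i, Matrix (Fin (d i)) (Fin (d i)) K) : IsTraceNondegenerate K H := by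
  intro w hw
  have h1 (x : H) : ∑ i, (e w i * e x i).trace * d i = 0 := by
    have h2 := trace_mulLeft_mulRight_of_algEquiv e (w * x) 1
    rw [LinearMap.mulRight_one, LinearMap.comp_id, ← regularChar_apply, hw] at h2
    rw [h2]
    exact Finset.sum_congr rfl fun i _ => by simp
  apply e.injective
  rw [map_zero]
  funext i
  refine Matrix.ext_iff_trace_mul_right.2 fun y => ?_
  have h2 := h1 (e.symm (Pi.single i y))
  rw [Finset.sum_eq_single i] at h2
  · simpa [(hd i).out] using h2
  · intro j _ hj
    simp [Pi.single_eq_of_ne hj]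
  · simp

end Matrices

/-! ### Traces of matrices of finite order -/

section RootsOfUnity

/-- The Fourier sums `P j` are the projections onto the `ζ^j`-eigenspaces of `w`, and `c j` is the
dimension of that eigenspace for `j < M`. -/
theorem exists_trace_pow_eq {K V : Type*} [Field K] [CharZero K] [AddCommGroup V] [Module K V]
    [Module.Finite K V] {w : Module.End K V} {M : ℕ} (hM : 0 < M) (hw : w ^ M = 1) {ζ : K}
    (hζ : IsPrimitiveRoot ζ M) :
    ∃ c : ℕ → ℕ, ∀ r, LinearMap.trace K V (w ^ r) =
      ∑ j ∈ Finset.range M, (c j : K) * (ζ ^ j) ^ r := by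
  have hM0 : (M : K) ≠ 0 := Nat.cast_ne_zero.2 hM.ne'
  have hζ0 : ζ ≠ 0 := hζ.ne_zero hM.ne'
  let P (j : ℕ) : Module.End K V := (M : K)⁻¹ • ∑ i ∈ Finset.range M, ((ζ ^ j)⁻¹ ^ i) • w ^ i
  have hPw (j : ℕ) : P j * w = ζ ^ j • P j := by
    have h1 : (ζ ^ j)⁻¹ ^ M = 1 := by
      rw [inv_pow, ← pow_mul, mul_comm, pow_mul, hζ.pow_eq_one, one_pow, inv_one]
    have h2 : ∑ i ∈ Finset.range M, ((ζ ^ j)⁻¹ ^ (i + 1)) • w ^ (i + 1) =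
        ∑ i ∈ Finset.range M, ((ζ ^ j)⁻¹ ^ i) • w ^ i := by
      have h3 := Finset.sum_range_succ' (fun i => ((ζ ^ j)⁻¹ ^ i) • w ^ i) M
      rw [Finset.sum_range_succ, h1, hw, pow_zero, pow_zero, add_left_inj] at h3
      exact h3.symm
    have hj : ζ ^ j ≠ 0 := pow_ne_zero _ hζ0
    simp only [P]
    rw [smul_mul_assoc, smul_comm, Finset.sum_mul, ← h2, Finset.smul_sum (r := ζ ^ j)]
    congr 1
    refine Finset.sum_congr rfl fun i _ => ?_
    rw [smul_mul_assoc, ← pow_succ, smul_smul, pow_succ (ζ ^ j)⁻¹, mul_comm _ (ζ ^ j)⁻¹,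
      mul_inv_cancel_left₀ hj]
  have hPwi (j i : ℕ) : P j * w ^ i = (ζ ^ j) ^ i • P j := by
    induction i with
    | zero => simp
    | succ i ih => rw [pow_succ, ← mul_assoc, ih, smul_mul_assoc, hPw, smul_smul, pow_succ]
  have hPP (j : ℕ) : IsIdempotentElem (P j) := by
    have hj : ζ ^ j ≠ 0 := pow_ne_zero _ hζ0
    rw [IsIdempotentElem]
    conv_lhs => enter [2]; simp only [P]
    rw [mul_smul_comm, Finset.mul_sum]
    simp only [mul_smul_comm, hPwi, smul_smul, ← mul_pow, inv_mul_cancel₀ hj, one_pow, one_smul]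
    rw [Finset.sum_const, Finset.card_range, ← Nat.cast_smul_eq_nsmul K, smul_smul,
      inv_mul_cancel₀ hM0, one_smul]
  have hsum : ∑ j ∈ Finset.range M, P j = 1 := by
    simp only [P]
    rw [← Finset.smul_sum, Finset.sum_comm, Finset.sum_eq_single 0]
    · simp [← Nat.cast_smul_eq_nsmul K, smul_smul, hM0]
    · intro i hi hi0
      rw [← Finset.sum_smul]
      have h1 : (ζ ^ i)⁻¹ ^ M = 1 := by
        rw [inv_pow, ← pow_mul, mul_comm, pow_mul, hζ.pow_eq_one, one_pow, inv_one]
      have h2 : (ζ ^ i)⁻¹ ≠ 1 := by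
        rw [Ne, inv_eq_one]
        exact hζ.pow_ne_one_of_pos_of_lt hi0 (Finset.mem_range.1 hi)
      have h3 : ∑ j ∈ Finset.range M, (ζ ^ j)⁻¹ ^ i = ∑ j ∈ Finset.range M, (ζ ^ i)⁻¹ ^ j :=
        Finset.sum_congr rfl fun j _ => by
          rw [inv_pow, inv_pow, ← pow_mul, ← pow_mul, mul_comm]
      rw [h3, geom_sum_eq h2, h1, sub_self, zero_div, zero_smul]
    · intro h
      exact absurd (Finset.mem_range.2 hM) h
  refine ⟨fun j => Module.finrank K (LinearMap.range (P j)), fun r => ?_⟩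
  rw [← one_mul (w ^ r), ← hsum, Finset.sum_mul, map_sum]
  refine Finset.sum_congr rfl fun j _ => ?_
  rw [hPwi, map_smul, (LinearMap.IsIdempotentElem.isProj_range _ (hPP j)).trace, smul_eq_mul,
    mul_comm]

/-- The exponent `M - 1` stands for `-1`. An embedding of `ℚ(ζ)` in `ℂ` turns inversion of `ζ` into
complex conjugation, so the sum becomes one of squared absolute values and each term vanishes. -/
theorem eq_zero_of_sum_eq_zero {K ι : Type*} [Field K] [CharZero K] [Fintype ι] {M : ℕ}
    (hM : 0 < M) {ζ : K} (hζ : IsPrimitiveRoot ζ M) (c : ι → ℕ → ℕ)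
    (h : ∑ i, (∑ j ∈ Finset.range M, (c i j : K) * (ζ ^ j) ^ 1) *
      (∑ j ∈ Finset.range M, (c i j : K) * (ζ ^ j) ^ (M - 1)) = 0) (i : ι) :
    ∑ j ∈ Finset.range M, (c i j : K) * (ζ ^ j) ^ (M - 1) = 0 := by
  have hint : IsIntegral ℚ ζ := (hζ.isIntegral hM).tower_top
  have : Algebra.IsAlgebraic ℚ (IntermediateField.adjoin ℚ {ζ}) :=
    IntermediateField.isAlgebraic_adjoin_simple hint
  let φ : IntermediateField.adjoin ℚ {ζ} →ₐ[ℚ] ℂ := IsAlgClosed.lift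
  let z : IntermediateField.adjoin ℚ {ζ} := ⟨ζ, IntermediateField.mem_adjoin_simple_self ℚ ζ⟩
  have hz : z ^ M = 1 := Subtype.ext hζ.pow_eq_one
  let f (i : ι) (r : ℕ) : IntermediateField.adjoin ℚ {ζ} :=
    ∑ j ∈ Finset.range M, (c i j : IntermediateField.adjoin ℚ {ζ}) * (z ^ j) ^ r
  have hf (i : ι) (r : ℕ) : algebraMap _ K (f i r) =
      ∑ j ∈ Finset.range M, (c i j : K) * (ζ ^ j) ^ r := by
    simp only [f, map_sum, map_mul, map_pow, map_natCast]
    rfl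
  simp only [← hf] at h ⊢
  rw [← map_zero (algebraMap (IntermediateField.adjoin ℚ {ζ}) K)]
  have h1 : ∑ i, f i 1 * f i (M - 1) = 0 := by
    apply (algebraMap (IntermediateField.adjoin ℚ {ζ}) K).injective
    rw [map_sum, map_zero, ← h]
    simp only [map_mul]
  have hφz : φ z ^ M = 1 := by rw [← map_pow, hz, map_one]
  have hconj : (starRingEnd ℂ) (φ z) = φ z ^ (M - 1) := by
    rw [← Complex.inv_eq_conj (Complex.norm_eq_one_of_pow_eq_one hφz hM.ne')]
    refine inv_eq_of_mul_eq_one_right ?_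
    rw [← pow_succ', Nat.sub_add_cancel hM, hφz]
  have h2 (i : ι) : φ (f i (M - 1)) = (starRingEnd ℂ) (φ (f i 1)) := by
    simp only [f, map_sum, map_mul, map_pow, map_natCast, hconj, pow_one]
    exact Finset.sum_congr rfl fun j _ => by rw [← pow_mul, ← pow_mul, mul_comm j]
  have h3 : ∑ i, Complex.normSq (φ (f i 1)) = 0 := by
    have h4 := congrArg φ h1
    rw [map_sum, map_zero] at h4
    simp only [map_mul, h2, Complex.mul_conj] at h4
    exact_mod_cast h4
  have h5 := (Finset.sum_eq_zero_iff_of_nonneg fun i _ => Complex.normSq_nonneg _).1 h3 i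
    (Finset.mem_univ i)
  congr 1
  rw [← map_eq_zero φ, h2, Complex.normSq_eq_zero.1 h5, map_zero]

/-- A matrix with a scalar power, and its inverse, have traces given by roots of unity. -/
theorem exists_trace_eq_sum_of_pow_eq_scalar {K : Type*} [Field K] [IsAlgClosed K] [CharZero K]
    {d : ℕ} [NeZero d] {u v : Matrix (Fin d) (Fin d) K} (huv : u * v = 1) {M : ℕ} (hM : 0 < M)
    {l : K} (hl : u ^ M = Matrix.scalar (Fin d) l) {ζ : K} (hζ : IsPrimitiveRoot ζ M) :
    ∃ (c : ℕ → ℕ) (m : K), m ≠ 0 ∧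
      u.trace = m * ∑ j ∈ Finset.range M, (c j : K) * (ζ ^ j) ^ 1 ∧
      v.trace = m⁻¹ * ∑ j ∈ Finset.range M, (c j : K) * (ζ ^ j) ^ (M - 1) := by
  have hvu : v * u = 1 := mul_eq_one_comm.1 huv
  have hcomm : Commute u v := huv.trans hvu.symm
  -- Dividing `u` by an `M`-th root `m` of `l` gives `w` with `w ^ M = 1` and `w ^ (M - 1) = m • v`.
  obtain ⟨m, hm⟩ := IsAlgClosed.exists_pow_nat_eq l hM
  have hl0 : l ≠ 0 := by
    rintro rfl
    have h1 : (1 : Matrix (Fin d) (Fin d) K) = 0 := by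
      rw [← one_pow M, ← huv, hcomm.mul_pow, hl, map_zero, zero_mul]
    exact one_ne_zero h1
  have hm0 : m ≠ 0 := by
    rintro rfl
    exact hl0 (by rw [← hm, zero_pow hM.ne'])
  let w : Matrix (Fin d) (Fin d) K := m⁻¹ • u
  have hw : w ^ M = 1 := by
    rw [smul_pow, hl, inv_pow, hm]
    ext i j
    by_cases hij : i = j
    · subst hij
      simp [hl0]
    · simp [hij]
  have hw' : w ^ (M - 1) = m • v := by
    have h1 : w * (m • v) = 1 := by
      rw [smul_mul_smul_comm, huv, inv_mul_cancel₀ hm0, one_smul]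
    calc w ^ (M - 1) = w ^ (M - 1) * (w * (m • v)) := by rw [h1, mul_one]
      _ = m • v := by rw [← mul_assoc, ← pow_succ, Nat.sub_add_cancel hM, hw, one_mul]
  obtain ⟨c, hc⟩ := exists_trace_pow_eq (w := Matrix.toLin' w) hM
    (by rw [← Matrix.toLin'_pow, hw, Matrix.toLin'_one]; rfl) hζ
  simp only [← Matrix.toLin'_pow, Matrix.trace_toLin'_eq] at hc
  refine ⟨c, m, hm0, ?_, ?_⟩
  · rw [← hc 1, pow_one, Matrix.trace_smul, smul_eq_mul, mul_inv_cancel_left₀ hm0]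
  · rw [← hc (M - 1), hw', Matrix.trace_smul, smul_eq_mul, inv_mul_cancel_left₀ hm0]

end RootsOfUnity

/-! ### The Larson–Radford theorem over an algebraically closed field -/

section AlgClosed

open HopfAlgebra

variable {K H : Type*} [Field K] [IsAlgClosed K] [CharZero K] [Ring H] [HopfAlgebra K H]
  [Module.Finite K H] {α : Module.Dual K H} {Λ : H}

theorem IsIntegralPair.apply_one_ne_zero (h : IsIntegralPair α Λ) {n : ℕ} {d : Fin n → ℕ}
    (hd : ∀ i, NeZero (d i)) (e : H ≃ₐ[K] ∀ i, Matrix (Fin (d i)) (Fin (d i)) K) : α 1 ≠ 0 := by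
  obtain ⟨u, hu, hu'⟩ := h.exists_antipodeSq_eq_conj (isTraceNondegenerate_of_algEquiv hd e)
  obtain ⟨M, hM, hc⟩ := h.exists_pow_central hu hu'
  -- Since `S²(y) = uyu⁻¹`, `α(x)` is the trace of `y ↦ xuyu⁻¹`, computed block by block.
  have hform (x : H) : α x = ∑ i, (e (x * u) i).trace * (e (↑u⁻¹ : H) i).trace := by
    rw [← trace_mulLeft_mulRight_of_algEquiv, ← h.trace_mulLeft_antipodeSq]
    congr 1
    ext y
    have h1 : antipode K (antipode K y) = u * y * (↑u⁻¹ : H) := by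
      rw [← hu, Units.mul_inv_cancel_right]
    simp [h1, mul_assoc]
  obtain ⟨ζ, hζ⟩ : ∃ ζ : K, IsPrimitiveRoot ζ M := by
    have : NeZero (M : K) := ⟨Nat.cast_ne_zero.2 hM.ne'⟩
    exact HasEnoughRootsOfUnity.exists_primitiveRoot K M
  have hscalar (i : Fin n) : ∃ l, (e u i) ^ M = Matrix.scalar (Fin (d i)) l := by
    have h1 : ∀ x, Commute x ((e u i) ^ M) := fun x => by
      have h2 := congrFun (congrArg e (hc (e.symm (Pi.single i x)))) i
      simp only [map_mul, map_pow, AlgEquiv.apply_symm_apply, Pi.mul_apply, Pi.pow_apply,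
        Pi.single_eq_same] at h2
      exact h2.symm
    obtain ⟨l, hl⟩ := Matrix.mem_range_scalar_of_commute_single fun a b _ => h1 _
    exact ⟨l, hl.symm⟩
  choose l hl using hscalar
  have huv (i : Fin n) : e u i * e (↑u⁻¹ : H) i = 1 := by
    rw [← Pi.mul_apply, ← map_mul, Units.mul_inv, map_one, Pi.one_apply]
  choose c m hm hcu hcv using fun i =>
    haveI := hd i
    exists_trace_eq_sum_of_pow_eq_scalar (huv i) hM (hl i) hζ
  intro h0
  have h1 := hform 1
  rw [h0, one_mul] at h1
  -- The scalars `m i` and `(m i)⁻¹` cancel in each summand of `α(1)`. If `α(1) = 0`, all traces of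
  -- `u⁻¹` vanish, and so does `α(Λ) = 1`.
  have h2 := eq_zero_of_sum_eq_zero hM hζ c (by
    rw [h1]
    refine Finset.sum_congr rfl fun i _ => ?_
    rw [hcu, hcv]
    have := hm i
    field_simp)
  have h3 := hform Λ
  rw [h.apply_eq] at h3
  simp [hcv, h2] at h3

theorem IsIntegralPair.apply_mul_comm [IsSemisimpleRing H] (h : IsIntegralPair α Λ) (x y : H) :
    α (x * y) = α (y * x) := by
  obtain ⟨n, d, hd, ⟨e⟩⟩ := IsSemisimpleRing.exists_algEquiv_pi_matrix_of_isAlgClosed K H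
  have h1 := LinearMap.congr_fun (h.antipodeSq_eq_id (isTraceNondegenerate_of_algEquiv hd e)
    (h.apply_one_ne_zero hd e)) x
  rw [h.apply_mul, show antipode K (antipode K x) = x from h1]

end AlgClosed

/-! ### Integrals and semisimplicity -/

section Maschke

open Coalgebra HopfAlgebra

variable {k H : Type*} [Field k] [Ring H] [HopfAlgebra k H]

/-- A semisimple Hopf algebra has a left integral `Λ` with `ε(Λ) = 1`. -/
theorem exists_integral_of_isSemisimpleRing [IsSemisimpleRing H] :
    ∃ Λ : H, (∀ h : H, h * Λ = counit (R := k) h • Λ) ∧ counit (R := k) Λ = 1 := by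
  let I : Submodule H H := RingHom.ker (Bialgebra.counitAlgHom k H)
  have hI (x : H) : x ∈ I ↔ counit (R := k) x = 0 := Iff.rfl
  obtain ⟨J, hJ⟩ := exists_isCompl I
  -- `Λ` is the component of 1 in a complement `J` of the augmentation ideal `I`; then `hΛ - ε(h)Λ`
  -- lies in `I ∩ J = 0`.
  obtain ⟨a, ha, Λ, hΛ, h1⟩ := Submodule.mem_sup.1
    (show (1 : H) ∈ I ⊔ J by rw [hJ.sup_eq_top]; trivial)
  have hε : counit (R := k) Λ = 1 := by
    rw [← Bialgebra.counit_one (R := k) (A := H), ← h1, map_add, (hI a).1 ha, zero_add]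
  refine ⟨Λ, fun h => ?_, hε⟩
  rw [← sub_eq_zero]
  refine (Submodule.disjoint_def.1 hJ.disjoint) _ ?_ ?_
  · rw [hI, map_sub, Bialgebra.counit_mul, map_smul, hε, smul_eq_mul, sub_self]
  · refine sub_mem (J.smul_mem h hΛ) ?_
    rw [← one_mul Λ, ← smul_mul_assoc]
    exact J.smul_mem _ hΛ

/-- `Λh` is again a left integral, so nondegeneracy makes it a multiple of `Λ`, and `ε` identifies
the factor as `ε(h)`. Thus `Λ` is two-sided. -/
theorem isIntegralPair_of_left [Module.Finite k H] {α : Module.Dual k H}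
    (hα : IsLeftIntegralOfDual α) (hα0 : α ≠ 0) {Λ : H}
    (hΛ : ∀ h : H, h * Λ = counit (R := k) h • Λ) (hε : counit (R := k) Λ = 1) :
    α Λ ≠ 0 ∧ IsIntegralPair ((α Λ)⁻¹ • α) Λ := by
  have h0 : α Λ ≠ 0 := fun h0 => by
    have h1 : Λ = 0 := hα.eq_zero_of_right hα0 fun x => by rw [hΛ, map_smul, h0, smul_zero]
    simp [h1] at hε
  have hright (h : H) : α Λ • (Λ * h) = α (Λ * h) • Λ := by
    rw [← sub_eq_zero]
    refine hα.eq_zero_of_right hα0 fun x => ?_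
    rw [mul_sub, mul_smul_comm, mul_smul_comm, ← mul_assoc, hΛ, smul_mul_assoc, map_sub,
      map_smul, map_smul, map_smul, map_smul]
    simp only [smul_eq_mul]
    ring
  refine ⟨h0, ?_, hΛ, fun h => ?_, hε, ?_⟩
  · rw [isLeftIntegralOfDual_iff] at hα ⊢
    intro h
    simp only [LinearMap.smul_apply, smul_assoc]
    rw [← smul_sw, hα]
  · have h1 := congrArg (counit (R := k)) (hright h)
    rw [map_smul, map_smul, Bialgebra.counit_mul, hε, one_mul, smul_eq_mul, smul_eq_mul,
      mul_one] at h1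
    apply smul_right_injective H h0
    simp only
    rw [hright, ← h1, mul_smul]
  · simp [h0]

/-- The element `∑ Λ₁ ⊗ S(Λ₂)` commutes with `H`, which makes averaging over `Λ` an `H`-linear
operation. -/
theorem sw_mul_integral {M : Type*} [AddCommGroup M] [Module k M] {Λ : H}
    (hΛ : ∀ h : H, h * Λ = counit (R := k) h • Λ) (f : H →ₗ[k] H →ₗ[k] M) (h : H) :
    (sw k Λ fun a b => f (h * a) (antipode k b)) =
      sw k Λ fun a b => f a (antipode k b * h) := by
  symm
  calc (sw k Λ fun a b => f a (antipode k b * h))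
      = sw k h fun p q => counit (R := k) p • sw k Λ fun a b => f a (antipode k b * q) := by
        simp only [smul_sw]
        rw [sw_swap (f := fun p q a b => counit (R := k) p • f a (antipode k b * q))]
        exact sw_congr fun a b =>
          (sw_counit_left (f a ∘ₗ LinearMap.mulLeft k (antipode k b)) h).symm
    _ = sw k h fun p q => sw k p fun c d => sw k Λ fun a b =>
          f (c * a) (antipode k b * (antipode k d * q)) := sw_congr fun p q => by
        rw [← sw_smul {}, ← hΛ, sw_mul {}]
        refine sw_congr fun c d => sw_congr fun a b => ?_
        rw [antipode_mul_antidistrib, mul_assoc]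
    _ = sw k h fun c r => sw k r fun d q => sw k Λ fun a b =>
          f (c * a) (antipode k b * (antipode k d * q)) :=
        sw_assoc ⟨fun _ _ _ _ => by simp only [add_mul, map_add, LinearMap.add_apply, sw_fun_add],
          fun _ _ _ _ => by simp only [smul_mul_assoc, map_smul, LinearMap.smul_apply, smul_sw],
          fun _ => {}⟩ h
    _ = sw k h fun c r => counit (R := k) r • sw k Λ fun a b => f (c * a) (antipode k b) := by
        refine sw_congr fun c r => ?_
        rw [sw_swap (f := fun d q a b => f (c * a) (antipode k b * (antipode k d * q))), smul_sw]
        refine sw_congr fun a b => ?_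
        rw [← map_sw, ← mul_sw, sw_antipode_mul, mul_smul_comm, mul_one, map_smul]
    _ = _ := by
        simp only [smul_sw]
        rw [sw_swap (f := fun c r a b => counit (R := k) r • f (c * a) (antipode k b))]
        exact sw_congr fun a b =>
          sw_counit_right (f.flip (antipode k b) ∘ₗ LinearMap.mulRight k a) h

/-- Maschke's theorem for Hopf algebras. -/
theorem isSemisimpleRing_of_integral {Λ : H} (hΛ : ∀ h : H, h * Λ = counit (R := k) h • Λ)
    (hε : counit (R := k) Λ = 1) : IsSemisimpleRing H := by
  refine { exists_isCompl := fun p => ?_ }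
  let p' : Submodule k H := p.restrictScalars k
  obtain ⟨q', hq'⟩ := exists_isCompl p'
  let π : H →ₗ[k] H := p'.subtype ∘ₗ Submodule.projectionOnto p' q' hq'
  have hπ (x : H) : π x ∈ p := (Submodule.projectionOnto p' q' hq' x).2
  have hπ' (x : H) (hx : x ∈ p) : π x = x :=
    congrArg Subtype.val (Submodule.projectionOnto_apply_left hq' ⟨x, hx⟩)
  have hmem (x : H) : (sw k Λ fun a b => a * π (antipode k b * x)) ∈ p :=
    Submodule.sum_mem _ fun i _ => p.smul_mem _ (hπ _)
  let Q : H →ₗ[H] p :=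
    { toFun := fun x => ⟨sw k Λ fun a b => a * π (antipode k b * x), hmem x⟩
      map_add' := fun x y => Subtype.ext <| by
        simp only [mul_add, map_add, sw_fun_add, Submodule.coe_add]
      map_smul' := fun h x => Subtype.ext <| by
        simp only [smul_eq_mul, RingHom.id_apply, SetLike.val_smul]
        rw [mul_sw]
        have h1 := sw_mul_integral hΛ ((LinearMap.mul k H).compl₂
          (π ∘ₗ LinearMap.mulRight k x)) h
        simp only [LinearMap.compl₂_apply, LinearMap.mul_apply', LinearMap.comp_apply,
          LinearMap.mulRight_apply, mul_assoc] at h1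
        exact h1.symm }
  refine ⟨LinearMap.ker Q, LinearMap.isCompl_of_proj fun x => Subtype.ext ?_⟩
  change (sw k Λ fun a b => a * π (antipode k b * x)) = x
  calc _ = sw k Λ fun a b => a * antipode k b * x := sw_congr fun a b => by
        rw [hπ' _ (show antipode k b * (x : H) ∈ p from p.smul_mem _ x.2), mul_assoc]
    _ = _ := by rw [← sw_mul_right, sw_mul_antipode, hε, one_smul, one_mul]

end Maschke

/-! ### Descent from the algebraic closure -/

section BaseChange

open Coalgebra HopfAlgebra

variable {k H : Type*} [Field k] [Ring H] [HopfAlgebra k H] (K : Type*) [Field K] [Algebra k K]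

variable {K}

theorem dualBaseChange_tmul (α : Module.Dual k H) (c : K) (x : H) :
    Module.Dual.baseChange K α (c ⊗ₜ x) = α x • c := by
  simp [Module.Dual.baseChange, Algebra.smul_def]

theorem isLeftIntegralOfDual_dualBaseChange {α : Module.Dual k H} (hα : IsLeftIntegralOfDual α) :
    IsLeftIntegralOfDual ((Module.Dual.baseChange K α)) := by
  intro z
  induction z using TensorProduct.induction_on with
  | zero => simp
  | add x y hx hy => simp only [map_add, hx, hy]
  | tmul c x =>
    rw [isLeftIntegralOfDual_iff] at hα
    have h1 : comul (R := K) (c ⊗ₜ[k] x : K ⊗[k] H) =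
        sw k x fun a b => ((1 : K) ⊗ₜ[k] a) ⊗ₜ[K] (c ⊗ₜ[k] b) := by
      rw [TensorProduct.comul_tmul, ← sw_tensor x, tmul_sw, sw, sw, map_sum]
      refine Finset.sum_congr rfl fun i _ => ?_
      simp
    rw [h1, sw, map_sum, map_sum]
    simp only [LinearMap.lTensor_tmul, TensorProduct.rid_tmul, dualBaseChange_tmul]
    have h2 := congrArg (fun y => c ⊗ₜ[k] y) (hα x)
    simp only [tmul_sw] at h2
    rw [sw] at h2
    rw [Algebra.algebraMap_eq_smul_one, Algebra.TensorProduct.one_def, TensorProduct.smul_tmul']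
    simp only [smul_eq_mul, mul_one]
    rw [TensorProduct.smul_tmul, ← h2]
    refine Finset.sum_congr rfl fun i _ => ?_
    rw [TensorProduct.tmul_smul, smul_assoc, TensorProduct.smul_tmul', smul_eq_mul, mul_one]

theorem mul_baseChange_integral {Λ : H} (hΛ : ∀ h : H, h * Λ = counit (R := k) h • Λ)
    (z : K ⊗[k] H) : z * (1 ⊗ₜ[k] Λ) = counit (R := K) z • (1 ⊗ₜ[k] Λ : K ⊗[k] H) := by
  induction z using TensorProduct.induction_on with
  | zero => simp
  | add x y hx hy => rw [add_mul, hx, hy, map_add, add_smul]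
  | tmul c x =>
    rw [Algebra.TensorProduct.tmul_mul_tmul, hΛ, TensorProduct.counit_tmul, mul_one,
      TensorProduct.tmul_smul, TensorProduct.smul_tmul', TensorProduct.smul_tmul']
    simp

/-- Over a field of characteristic zero, the left integrals of the dual of a semisimple Hopf
algebra are trace functionals. -/
theorem IsLeftIntegralOfDual.apply_mul_comm [CharZero k] [Module.Finite k H] [IsSemisimpleRing H]
    {α : Module.Dual k H} (hα : IsLeftIntegralOfDual α) (x y : H) : α (x * y) = α (y * x) := by
  rcases eq_or_ne α 0 with rfl | hα0
  · rfl
  obtain ⟨Λ, hΛ, hε⟩ := exists_integral_of_isSemisimpleRing (k := k) (H := H)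
  let K := AlgebraicClosure k
  have : CharZero K := charZero_of_injective_algebraMap (algebraMap k K).injective
  have hΛK := mul_baseChange_integral (K := K) hΛ
  have hεK : counit (R := K) (1 ⊗ₜ[k] Λ : K ⊗[k] H) = 1 := by
    rw [TensorProduct.counit_tmul, hε]
    simp
  have hα0K : (Module.Dual.baseChange K α) ≠ 0 := fun h0 => by
    obtain ⟨x, hx⟩ : ∃ x, α x ≠ 0 := by
      by_contra! h
      exact hα0 (LinearMap.ext h)
    have h1 := LinearMap.congr_fun h0 (1 ⊗ₜ x)
    rw [dualBaseChange_tmul, LinearMap.zero_apply, smul_eq_zero] at h1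
    exact h1.elim hx one_ne_zero
  -- Semisimplicity passes to `K ⊗ H` through the integral, which survives every field extension.
  have : IsSemisimpleRing (K ⊗[k] H) := isSemisimpleRing_of_integral hΛK hεK
  obtain ⟨h0, hpair⟩ :=
    isIntegralPair_of_left (isLeftIntegralOfDual_dualBaseChange hα) hα0K hΛK hεK
  have h1 := hpair.apply_mul_comm (1 ⊗ₜ x) (1 ⊗ₜ y)
  rw [LinearMap.smul_apply, LinearMap.smul_apply] at h1
  have h2 := smul_right_injective K (inv_ne_zero h0) h1
  rw [Algebra.TensorProduct.tmul_mul_tmul, Algebra.TensorProduct.tmul_mul_tmul,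
    dualBaseChange_tmul, dualBaseChange_tmul, mul_one] at h2
  exact smul_left_injective k (one_ne_zero (α := K)) h2

end BaseChange

/-! ### Dual bases and the Hattori–Stallings trace -/

section DualBasis

open MulOpposite

variable {R : Type*} [Ring R] {P : Type*} [AddCommGroup P] [Module Rᵐᵒᵖ P]
  {ι : Type*} [Fintype ι] {x : ι → P} {f : ι → RightDual R P}

theorem finite_projective_of_dualBasis (h : ∀ y, ∑ i, op (f i y) • x i = y) :
    Module.Finite Rᵐᵒᵖ P ∧ Module.Projective Rᵐᵒᵖ P := by
  classical
  let F : (ι → Rᵐᵒᵖ) →ₗ[Rᵐᵒᵖ] P := Fintype.linearCombination Rᵐᵒᵖ x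
  let G : P →ₗ[Rᵐᵒᵖ] (ι → Rᵐᵒᵖ) :=
    { toFun := fun y i => op (f i y)
      map_add' := fun y z => by ext i; simp
      map_smul' := fun r y => by ext i; simp }
  have hFG : F ∘ₗ G = LinearMap.id := LinearMap.ext fun y => h y
  exact ⟨Module.Finite.of_surjective F fun y => ⟨G y, LinearMap.congr_fun hFG y⟩,
    Module.Projective.of_split G F hFG⟩

theorem hattoriStallings_eq_sum [Module.Finite Rᵐᵒᵖ P] [Module.Projective Rᵐᵒᵖ P]
    (h : ∀ y, ∑ i, op (f i y) • x i = y) (F : Module.End Rᵐᵒᵖ P) :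
    hattoriStallings R P F = ∑ i, modComm R (f i (F (x i))) := by
  have h1 : hsPhi R P (∑ i, BalancedTensor.tmul R (F (x i)) (f i)) = F := by
    ext y
    rw [map_sum, LinearMap.sum_apply]
    simp only [hsPhi_tmul]
    conv_rhs => rw [← h y, map_sum]
    simp
  have h2 : (AddEquiv.ofBijective (hsPhi R P) (hsPhi_bijective R P)).symm F =
      ∑ i, BalancedTensor.tmul R (F (x i)) (f i) := by
    rw [AddEquiv.symm_apply_eq]
    exact h1.symm
  change hsPsi R P ((AddEquiv.ofBijective (hsPhi R P) (hsPhi_bijective R P)).symm F) = _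
  rw [h2, map_sum]
  rfl

end DualBasis

/-! ### Prime rings over a central subalgebra -/

section Central

open MulOpposite

variable {k : Type*} [Field k] {B : Type*} [Ring B] [Algebra k B]

theorem addCommutator_eq_bot {A : Subalgebra k B} (hA : A ≤ Subalgebra.center k B) :
    addCommutator A = ⊥ := by
  rw [addCommutator, AddSubgroup.closure_eq_bot_iff]
  rintro _ ⟨a, b, rfl⟩
  rw [Set.mem_singleton_iff, sub_eq_zero]
  exact Subtype.ext (Subalgebra.mem_center_iff.1 (hA b.2) a)

theorem trace_ne_zero_of_isIdempotentElem {F ι : Type*} [Field F] [CharZero F] [Fintype ι]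
    {E : Matrix ι ι F} (hE : IsIdempotentElem E) (hE0 : E ≠ 0) : E.trace ≠ 0 := by
  classical
  rw [← Matrix.trace_toLin'_eq]
  have h1 : IsIdempotentElem (Matrix.toLin' E) := by
    rw [IsIdempotentElem, Module.End.mul_eq_comp, ← Matrix.toLin'_mul, hE]
  exact fun h0 => hE0 (Matrix.toLin'.injective
    (((LinearMap.IsIdempotentElem.trace_eq_zero_iff h1).1 h0).trans (map_zero _).symm))

/-- The trace `τ : B → A` vanishes on commutators because `A` is commutative, and `τ(1)a = τ(a) = 0`
because `A` is central. Primeness makes the centre a domain, so it suffices that `τ(1) ≠ 0` in its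
fraction field. -/
theorem eq_zero_of_mem_addCommutator [CharZero k] (hB : IsPrimeRing B) {A : Subalgebra k B}
    (hA : A ≤ Subalgebra.center k B) {ι : Type*} [Fintype ι] {x : ι → B}
    {f : ι → RightDual A B} (h : ∀ y, ∑ i, op (f i y) • x i = y) (a : A)
    (ha : (a : B) ∈ addCommutator B) : a = 0 := by
  classical
  have := hB.1
  have hc (a : A) (b : B) : (a : B) * b = b * a := (Subalgebra.mem_center_iff.1 (hA a.2) b).symm
  have hcA (a b : A) : a * b = b * a := Subtype.ext (hc a b)
  have hsmul (i : ι) (b : B) (a : A) : f i (b * a) = f i b * a := (f i).map_smul (op a) b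
  have hx (y : B) : ∑ i, x i * (f i y : B) = y := h y
  let τ : B →+ A := ∑ i, (f i).toAddMonoidHom.comp (AddMonoidHom.mulRight (x i))
  have hτ (b : B) : τ b = ∑ i, f i (b * x i) := by
    simp [τ]
  have hexp (i : ι) (y z : B) : f i (y * z) = ∑ j, f i (y * x j) * f j z := by
    conv_lhs => rw [← hx z, Finset.mul_sum, map_sum]
    exact Finset.sum_congr rfl fun j _ => by rw [← mul_assoc, hsmul]
  have hτc (y z : B) : τ (y * z) = τ (z * y) := by
    simp only [hτ, mul_assoc]
    rw [Finset.sum_congr rfl fun i _ => hexp i y (z * x i),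
      Finset.sum_congr rfl fun i _ => hexp i z (y * x i), Finset.sum_comm]
    exact Finset.sum_congr rfl fun i _ => Finset.sum_congr rfl fun j _ => hcA _ _
  have hτ0 : τ a = 0 := by
    refine AddSubgroup.closure_induction (p := fun b _ => τ b = 0) ?_ (map_zero τ) ?_ ?_ ha
    · rintro _ ⟨y, z, rfl⟩
      rw [map_sub, hτc, sub_self]
    · intro y z _ _ hy hz
      rw [map_add, hy, hz, add_zero]
    · intro y _ hy
      rw [map_neg, hy, neg_zero]
  let Z := Subalgebra.center k B
  have : NoZeroDivisors Z := ⟨fun {y z} hyz => by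
    have h1 := hB.2 y z fun r => by
      rw [← Subalgebra.mem_center_iff.1 y.2 r, mul_assoc]
      rw [show (y : B) * z = ((y * z : Z) : B) from rfl, hyz]
      simp
    exact h1.imp (fun h => Subtype.ext h) fun h => Subtype.ext h⟩
  have : IsDomain Z := NoZeroDivisors.to_isDomain Z
  have : CharZero Z := charZero_of_injective_algebraMap (algebraMap k Z).injective
  have : CharZero (FractionRing Z) :=
    charZero_of_injective_algebraMap (IsFractionRing.injective Z (FractionRing Z))
  let φ : A →+* FractionRing Z :=
    (algebraMap Z (FractionRing Z)).comp (Subalgebra.inclusion hA).toRingHom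
  have hφ : Function.Injective φ := (IsFractionRing.injective Z (FractionRing Z)).comp
    (Subalgebra.inclusion_injective hA)
  -- The dual basis relation makes `E` idempotent, with trace `φ (τ 1)`; `E = 0` would force `x = 0`
  -- and `B = 0`.
  let E : Matrix ι ι (FractionRing Z) := fun i j => φ (f i (x j))
  have hE : E * E = E := by
    ext i l
    rw [Matrix.mul_apply]
    simp only [E, ← map_mul, ← map_sum]
    have h1 := hexp i 1 (x l)
    simp only [one_mul] at h1
    rw [h1]
  have htr : φ (τ 1) = E.trace := by
    rw [hτ, map_sum]
    simp only [one_mul]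
    rfl
  have hE0 : E ≠ 0 := by
    intro h2
    have h3 (i j : ι) : f i (x j) = 0 := hφ (by rw [map_zero]; exact congrFun (congrFun h2 i) j)
    have h4 (j : ι) : x j = 0 := by
      rw [← hx (x j)]
      simp [h3]
    apply one_ne_zero (α := B)
    rw [← hx 1]
    simp [h4]
  have h1 : τ 1 * a = 0 := by
    rw [← hτ0, hτ, hτ, Finset.sum_mul]
    exact Finset.sum_congr rfl fun i _ => by rw [one_mul, ← hsmul, hc]
  have h2 := congrArg φ h1
  rw [map_mul, htr, map_zero, mul_eq_zero] at h2
  exact hφ ((h2.resolve_left (trace_ne_zero_of_isIdempotentElem hE hE0)).trans (map_zero φ).symm)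

end Central

/-! ### The action of `H*` and the canonical map -/

section DualAction

variable {k : Type*} [Field k] {H : Type*} [Ring H] [HopfAlgebra k H]
  {B : Type*} [Ring B] [Algebra k B]

/-- The map `id ⊗ f : B ⊗ H → B`. -/
noncomputable def evalRight (B : Type*) [Ring B] [Algebra k B] (f : Module.Dual k H) :
    B ⊗[k] H →ₗ[k] B :=
  (TensorProduct.rid k B).toLinearMap ∘ₗ f.lTensor B

@[simp] theorem evalRight_tmul (f : Module.Dual k H) (b : B) (h : H) :
    evalRight B f (b ⊗ₜ h) = f h • b := by
  simp [evalRight]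

theorem evalRight_tmul_one_mul (f : Module.Dual k H) (b : B) (z : B ⊗[k] H) :
    evalRight B f ((b ⊗ₜ 1) * z) = b * evalRight B f z := by
  induction z using TensorProduct.induction_on with
  | zero => simp
  | add x y hx hy => rw [mul_add, map_add, hx, hy, map_add, mul_add]
  | tmul c h => simp

theorem evalRight_mul_tmul_one (f : Module.Dual k H) (b : B) (z : B ⊗[k] H) :
    evalRight B f (z * (b ⊗ₜ 1)) = evalRight B f z * b := by
  induction z using TensorProduct.induction_on with
  | zero => simp
  | add x y hx hy => rw [add_mul, map_add, hx, hy, map_add, add_mul]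
  | tmul c h => simp

theorem evalRight_one_tmul_mul {f g : Module.Dual k H} {h : H} (hfg : ∀ x, f (h * x) = g x)
    (z : B ⊗[k] H) : evalRight B f ((1 ⊗ₜ h) * z) = evalRight B g z := by
  induction z using TensorProduct.induction_on with
  | zero => simp
  | add x y hx hy => rw [mul_add, map_add, hx, hy, map_add]
  | tmul c x => simp [hfg]

theorem modComm_evalRight_mul_comm {f : Module.Dual k H} (hf : ∀ x y, f (x * y) = f (y * x))
    (X Y : B ⊗[k] H) :
    modComm B (evalRight B f (X * Y)) = modComm B (evalRight B f (Y * X)) := by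
  induction X using TensorProduct.induction_on with
  | zero => simp
  | add x y hx hy => simp only [add_mul, mul_add, map_add, hx, hy]
  | tmul b h =>
    induction Y using TensorProduct.induction_on with
    | zero => simp
    | add x y hx hy => simp only [add_mul, mul_add, map_add, hx, hy]
    | tmul c g =>
      rw [← sub_eq_zero, ← map_sub]
      refine (QuotientAddGroup.eq_zero_iff _).2 (AddSubgroup.subset_closure ⟨f (h * g) • b, c, ?_⟩)
      simp [hf g h]

variable [RightComoduleAlgebra k H B]

theorem dualAct_eq (f : Module.Dual k H) (b : B) :
    dualAct f b = evalRight B f (coact k H B b) := rfl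

theorem dualAct_counit (b : B) : dualAct (Coalgebra.counit (R := k) (A := H)) b = b :=
  LinearMap.congr_fun (RightComoduleAlgebra.counital (k := k) (H := H) (B := B)) b

/-- By coassociativity `ρ(α ⇀ b) = ∑ b₀ ⊗ b₁⟨α, b₂⟩`, and the integral property collapses this to
`(α ⇀ b) ⊗ 1`. -/
theorem dualAct_mem_coinvariants {α : Module.Dual k H} (hα : IsLeftIntegralOfDual α) (b : B) :
    dualAct α b ∈ coinvariants k H B := by
  rw [mem_coinvariants, dualAct_eq]
  let L : B ⊗[k] (H ⊗[k] H) →ₗ[k] B ⊗[k] H :=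
    LinearMap.lTensor B ((TensorProduct.rid k H).toLinearMap ∘ₗ α.lTensor H)
  have h1 : (coact k H B).toLinearMap ∘ₗ evalRight B α = L ∘ₗ
      (TensorProduct.assoc k B H H).toLinearMap ∘ₗ (coact k H B).toLinearMap.rTensor H := by
    refine TensorProduct.ext' fun c h => ?_
    simp only [LinearMap.comp_apply, evalRight_tmul, LinearMap.rTensor_tmul, map_smul]
    generalize (coact k H B).toLinearMap c = z
    induction z using TensorProduct.induction_on with
    | zero => simp
    | add x y hx hy => simp only [smul_add, TensorProduct.add_tmul, map_add, hx, hy]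
    | tmul d g => simp [L]
  have h2 : L ∘ₗ (Coalgebra.comul (R := k) (A := H)).lTensor B =
      (TensorProduct.mk k B H).flip 1 ∘ₗ evalRight B α := by
    refine TensorProduct.ext' fun c h => ?_
    have h3 := hα h
    simp only [L, LinearMap.comp_apply, LinearMap.lTensor_tmul]
    rw [LinearEquiv.coe_coe, h3, evalRight_tmul, Algebra.algebraMap_eq_smul_one]
    simp [TensorProduct.smul_tmul']
  have h3 := LinearMap.congr_fun h1 (coact k H B b)
  have h4 := LinearMap.congr_fun h2 (coact k H B b)
  have h5 := LinearMap.congr_fun (RightComoduleAlgebra.coassoc (k := k) (H := H) (B := B)) b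
  simp only [LinearMap.comp_apply] at h3 h4 h5
  exact h3.trans ((congrArg L h5).trans h4)

theorem dualAct_mul_coinvariant (f : Module.Dual k H) (b : B) {a : B}
    (ha : a ∈ coinvariants k H B) : dualAct f (b * a) = dualAct f b * a := by
  rw [dualAct_eq, map_mul, (mem_coinvariants k H B a).1 ha, evalRight_mul_tmul_one, dualAct_eq]

/-- The map `b ↦ α ⇀ (y b)` from `B` to the coinvariants, for a left integral `α` of `H*`. -/
noncomputable def integralDual {α : Module.Dual k H} (hα : IsLeftIntegralOfDual α) (y : B) :
    RightDual (coinvariants k H B) B where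
  toFun b := ⟨dualAct α (y * b), dualAct_mem_coinvariants hα _⟩
  map_add' b c := Subtype.ext <| by
    change dualAct α (y * (b + c)) = dualAct α (y * b) + dualAct α (y * c)
    simp only [dualAct_eq, mul_add, map_add]
  map_smul' a b := Subtype.ext <| by
    change dualAct α (y * (b * (a.unop : B))) = dualAct α (y * b) * (a.unop : B)
    rw [← mul_assoc, dualAct_mul_coinvariant _ _ a.unop.2]

theorem exists_finset_galoisMap_eq (hG : IsHopfGalois k H B) (h : H) :
    ∃ s : Finset (B × B), ∑ p ∈ s, (p.1 ⊗ₜ[k] (1 : H)) * coact k H B p.2 = 1 ⊗ₜ h := by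
  obtain ⟨z, hz⟩ := hG.2 (1 ⊗ₜ h)
  induction z using QuotientAddGroup.induction_on with
  | H w =>
    obtain ⟨s, hs⟩ := TensorProduct.exists_finset w
    refine ⟨s, ?_⟩
    rw [← hz, hs]
    change _ = galoisMap k H B (QuotientAddGroup.mk' _ (∑ i ∈ s, i.1 ⊗ₜ[ℤ] i.2))
    rw [map_sum, map_sum]
    rfl

end DualAction

end HopfGaloisTrace

/-! ### The trace formula -/

theorem mainTheorem9 {k : Type*} [Field k] [CharZero k]
    {H : Type*} [Ring H] [HopfAlgebra k H] [Module.Finite k H] [IsSemisimpleRing H]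
    {B : Type*} [Ring B] [Algebra k B] [HopfGaloisTrace.RightComoduleAlgebra k H B]
    (hGalois : HopfGaloisTrace.IsHopfGalois k H B)
    (α : Module.Dual k H) (hα0 : α ≠ 0) (hα : HopfGaloisTrace.IsLeftIntegralOfDual α)
    (t : H) (ht : HopfGaloisTrace.dualRightAct α t = Coalgebra.counit (R := k) (A := H)) :
    ∃ (_ : Module.Finite (HopfGaloisTrace.coinvariants k H B)ᵐᵒᵖ B)
      (_ : Module.Projective (HopfGaloisTrace.coinvariants k H B)ᵐᵒᵖ B),
      (∀ b : B,
        HopfGaloisTrace.ModCommutator.map (HopfGaloisTrace.coinvariants k H B).val.toRingHom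
            (HopfGaloisTrace.extensionTrace (HopfGaloisTrace.coinvariants k H B) b) =
          HopfGaloisTrace.modComm B
            (HopfGaloisTrace.dualAct (Coalgebra.counit (R := k) t • α) b)) ∧
      (HopfGaloisTrace.IsPrimeRing B →
        HopfGaloisTrace.coinvariants k H B ≤ Subalgebra.center k B →
        HopfGaloisTrace.addCommutator (HopfGaloisTrace.coinvariants k H B) = ⊥ ∧
        ∀ b : B,
          ∃ hb : HopfGaloisTrace.dualAct (Coalgebra.counit (R := k) t • α) b ∈
              HopfGaloisTrace.coinvariants k H B,
            HopfGaloisTrace.extensionTrace (HopfGaloisTrace.coinvariants k H B) b =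
              HopfGaloisTrace.modComm (HopfGaloisTrace.coinvariants k H B)
                ⟨HopfGaloisTrace.dualAct (Coalgebra.counit (R := k) t • α) b, hb⟩) := by
  open HopfGaloisTrace in
  -- The pairs in `s` are the `(r_i, l_i)`; the target `1 ⊗ S(t)` is chosen because `α(S(t)x) =
  -- ε(x)`.
  obtain ⟨s, hs⟩ := exists_finset_galoisMap_eq hGalois (HopfAlgebra.antipode k t)
  have hαc := hα.apply_mul_comm
  have hαt (x : H) : α (HopfAlgebra.antipode k t * x) = Coalgebra.counit (R := k) x := by
    rw [hαc]
    exact LinearMap.congr_fun ht x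
  have hbasis (b : B) : ∑ p : s, MulOpposite.op (integralDual hα (p : B × B).2 b) • (p : B × B).1
      = b := by
    rw [Finset.sum_coe_sort s fun p => MulOpposite.op (integralDual hα p.2 b) • p.1]
    calc _ = ∑ p ∈ s, p.1 * dualAct α (p.2 * b) := rfl
      _ = evalRight B α ((∑ p ∈ s, (p.1 ⊗ₜ[k] (1 : H)) * coact k H B p.2) * coact k H B b) := by
        rw [Finset.sum_mul, map_sum]
        refine Finset.sum_congr rfl fun p _ => ?_
        rw [mul_assoc, ← map_mul, evalRight_tmul_one_mul, dualAct_eq]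
      _ = b := by rw [hs, evalRight_one_tmul_mul hαt, ← dualAct_eq, dualAct_counit]
  have hsum : ∑ p ∈ s, p.1 * p.2 = Coalgebra.counit (R := k) t • (1 : B) := by
    have h1 := congrArg (evalRight B (Coalgebra.counit (R := k) (A := H))) hs
    rw [map_sum, evalRight_tmul, HopfAlgebra.counit_antipode] at h1
    rw [← h1]
    exact Finset.sum_congr rfl fun p _ => by
      rw [evalRight_tmul_one_mul, ← dualAct_eq, dualAct_counit]
  obtain ⟨hfin, hproj⟩ := finite_projective_of_dualBasis hbasis
  have htrace (b : B) : extensionTrace (coinvariants k H B) b =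
      modComm (coinvariants k H B) (∑ p : s, integralDual hα (p : B × B).2 (b * (p : B × B).1)) := by
    rw [extensionTrace, hattoriStallings_eq_sum hbasis, map_sum]
    rfl
  have hmap (b : B) : modComm B ((∑ p : s, integralDual hα (p : B × B).2 (b * (p : B × B).1) :
      coinvariants k H B) : B) = modComm B (dualAct (Coalgebra.counit (R := k) t • α) b) := by
    have h1 : dualAct (Coalgebra.counit (R := k) t • α) b =
        ∑ p ∈ s, dualAct α (p.1 * (p.2 * b)) := by
      have h2 : ∑ p ∈ s, p.1 * (p.2 * b) = Coalgebra.counit (R := k) t • b := by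
        simp only [← mul_assoc]
        rw [← Finset.sum_mul, hsum, smul_mul_assoc, one_mul]
      simp only [dualAct_eq]
      rw [← map_sum, ← map_sum, h2, map_smul, map_smul]
      simp [evalRight]
    rw [h1, AddSubmonoidClass.coe_finsetSum, map_sum, map_sum,
      Finset.sum_coe_sort s fun p => modComm B (integralDual hα p.2 (b * p.1) : B)]
    refine Finset.sum_congr rfl fun p _ => ?_
    change modComm B (dualAct α (p.2 * (b * p.1))) = _
    -- The trace property of `α` moves `r_i` from the right end of `l_i b r_i` to the left, modulo
    -- `[B,B]`.
    rw [dualAct_eq, dualAct_eq, ← mul_assoc, map_mul, modComm_evalRight_mul_comm hαc, ← map_mul]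
  refine ⟨hfin, hproj, fun b => ?_, fun hB hA => ⟨addCommutator_eq_bot hA, fun b => ?_⟩⟩
  · rw [htrace, ← hmap]
    rfl
  · have hb : dualAct (Coalgebra.counit (R := k) t • α) b ∈ coinvariants k H B := by
      have h1 : dualAct (Coalgebra.counit (R := k) t • α) b =
          Coalgebra.counit (R := k) t • dualAct α b := by
        simp [dualAct]
      rw [h1]
      exact Subalgebra.smul_mem _ (dualAct_mem_coinvariants hα b) _
    refine ⟨hb, ?_⟩
    rw [htrace]
    congr 1
    rw [← sub_eq_zero]
    -- Both sides lie in `A` and agree modulo `[B,B]` by `hmap`.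
    refine eq_zero_of_mem_addCommutator hB hA hbasis _ ?_
    rw [← QuotientAddGroup.eq_zero_iff]
    exact (map_sub (modComm B) _ _).trans (sub_eq_zero.2 (hmap b))
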